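/- Setting. Let $d\ge 1$, let $\mathcal F=\bigoplus_n\mathcal F_n$ be the bosonic Fock space over $L^2(\mathbb R^d)$, with annihilation operators $a(f)$ (antilinear in $f$) and creation operators $a^*(f)=a(f)^*$. A state $\omega$ is given by a density matrix on $\mathcal F$ with $\omega(a^*(f)a(f))<\infty$ for all $f\in L^2(\mathbb R^d)$. Let $\omega_\sigma$, $\sigma>0$, be a family of states. For open bounded $\mathcal O\subset\mathbb R^d$ let $L^2(\mathcal O)\subset L^2(\mathbb R^d)$ be the functions supported in $\mathcal O$ and let $R(\mathcal O)=\{f\in L^2(\mathcal O):\limsup_{\sigma\to\infty}\omega_\sigma(a^*(f)a(f))<\infty\}$. The family has a proper condensate in $\mathcal O$ if $R(\mathcal O)$ is closed and its orthogonal complement in $L^2(\mathcal O)$ is the ray $\mathbb C s$ of a normalized function $s$; put $n_C(\sigma)=\omega_\sigma(a^*(s)a(s))$. Let $(e^{ixP}f)(u)=f(u+x)$. The condensate is homogeneous if $$n_C(\sigma)^{-1}\,\omega_\sigma\big(a^*(e^{ixP}f)a(e^{ixP}g)\big)\to\langle s,f\rangle\langle g,s\rangle$$ along all sequences $\sigma_k\to\infty$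 with $n_C(\sigma_k)\to\infty$, for all $f,g\in L^2(\mathcal O_0)$, all open $\mathcal O_0$ and all $x\in\mathbb R^d$ such that the closures of $\mathcal O_0$ and of the shifted support region $\mathcal O_0-x$ are contained in $\mathcal O$. Theorem. Let $\mathcal O_0\subset\mathcal O$ be concentric balls in $\mathbb R^d$ of diameters $0<L_0<L$, and let $\omega_\sigma$ describe a homogeneous proper condensate in $\mathcal O$. For $k\in\mathbb R^d$ let $e_k(u)=|\mathcal O|^{-1/2}e^{iku}$ for $u\in\mathcal O$ and $e_k(u)=0$ otherwise. Let $\tilde f(p)=(2\pi)^{-d/2}\int e^{-ipu}f(u)\,du$ and $$F_d(t)=\frac{\int_{-1}^1(1-v^2)^{(d-1)/2}\cos(tv)\,dv}{\int_{-1}^1(1-v^2)^{(d-1)/2}\,dv}\qquad\Big(=\Gamma(\tfrac d2+1)\,(2/t)^{d/2}J_{d/2}(t)\ \text{for}\ t>0\Big).$$ There is $p\in\mathbb R^d$ (the condensate momentum) such that $s=z\,e_p$ with $|z|=1$, and the following holds. (0) There are $n_R\ge0$ and $\sigma_0>0$ such that for all $\sigma\ge\sigma_0$ $$\omega_\sigma(a^*(f)a(f))\le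 n_R\|f\|^2\quad\text{for all } f\in R(\mathcal O),\qquad(*)$$ whereas $\limsup_{\sigma\to\infty}n_C(\sigma)=\infty$. (i) (ODLRO) Let $\sigma>0$ and $n_R\ge0$ be such that $(*)$ holds at $\sigma$. If $n_C(\sigma)/|\mathcal O|>n_R/|\mathcal O_0|$, then for every $f\in L^2(\mathcal O_0)$ with $\|f\|=1$ and all $x,y$ such that the closures of $\mathcal O_0+x$ and $\mathcal O_0+y$ are contained in $\mathcal O$, $$\Big|\omega_\sigma\big(a^*(e^{ixP}f)a(e^{iyP}f)\big)-\frac{n_C(\sigma)}{|\mathcal O|}\,e^{i(x-y)p}\,(2\pi)^d|\tilde f(p)|^2\Big|\le 3\,\Big(n_R\,n_C(\sigma)\frac{|\mathcal O_0|}{|\mathcal O|}\Big)^{1/2}.$$ The differences $x-y$ of such $x,y$ are exactly the vectors of length less than $L-L_0$. (ii) (Momentum distribution) Let $\sigma>0$ and $n_R\ge0$ be such that $(*)$ holds at $\sigma$. If $n_C(\sigma)>n_R$, then $\omega_\sigma(a^*(e_p)a(e_p))=n_C(\sigma)$ and for all $k\in\mathbb R^d$ $$\Big|\omega_\sigma(a^*(e_k)a(e_k))-n_C(\sigma)\,F_d\big(L|k-p|/2\big)^2\Big|\le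 3\,\big(n_R\,n_C(\sigma)\big)^{1/2}.$$ The leading term has its peak at $k=p$: $F_d(0)=1$, and $|F_d(t)|<1$, $|F_d(t)|\le d/t$ for $t>0$. If $d=3$, then for $t>0$ $$F_d(t)^2=d^2\,t^{-2d}\Big(\int_0^t r^{d-2}\sin r\,dr\Big)^2 .$$ -/

import Mathlib

open MeasureTheory Filter Topology Set
open scoped InnerProductSpace ENNReal

noncomputable section

namespace BoseGas

/-! ### One-particle and `n`-particle spaces -/

/-- Position space `ℝ^d` with the Euclidean norm. -/
abbrev Pos (d : ℕ) : Type := EuclideanSpace ℝ (Fin d)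

/-- The single particle space `L²(ℝ^d)`. -/
abbrev OneParticle (d : ℕ) : Type := Lp ℂ 2 (volume : Measure (Pos d))

/-- The (unsymmetrized) `n`-fold tensor product `L²(ℝ^d)^{⊗ n} = L²((ℝ^d)^n)`. -/
abbrev Tensor (d n : ℕ) : Type := Lp ℂ 2 (volume : Measure (Fin n → Pos d))

theorem measurePreserving_perm (d n : ℕ) (π : Equiv.Perm (Fin n)) :
    MeasurePreserving (fun x : Fin n → Pos d => fun i => x (π i)) volume volume := by
  have h := volume_measurePreserving_piCongrLeft (fun _ : Fin n => Pos d) π.symm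
  convert h using 1
  funext x i
  have := MeasurableEquiv.piCongrLeft_apply_apply (β := fun _ : Fin n => Pos d) π.symm x (π i)
  simpa using this.symm

/-- The unitary exchange of particles `ψ(x₁, …, xₙ) ↦ ψ(x_{π 1}, …, x_{π n})`. -/
def permute (d n : ℕ) (π : Equiv.Perm (Fin n)) : Tensor d n →L[ℂ] Tensor d n :=
  (Lp.compMeasurePreservingₗᵢ ℂ (fun x : Fin n → Pos d => fun i => x (π i))
    (measurePreserving_perm d n π)).toContinuousLinearMap

/-- The wave functions in `L²(ℝ^d)^{⊗ n}` that are symmetric under all exchanges. -/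
def symmetric (d n : ℕ) : Submodule ℂ (Tensor d n) :=
  ⨅ π : Equiv.Perm (Fin n), (permute d n π - ContinuousLinearMap.id ℂ (Tensor d n)).ker

theorem isClosed_symmetric (d n : ℕ) : IsClosed (symmetric d n : Set (Tensor d n)) := by
  rw [symmetric, Submodule.coe_iInf]
  exact isClosed_iInter fun π =>
    (permute d n π - ContinuousLinearMap.id ℂ (Tensor d n)).isClosed_ker

instance instCompleteSymmetric (d n : ℕ) : CompleteSpace (symmetric d n) :=
  (isClosed_symmetric d n).completeSpace_coe

/-- The bosonic `n`-particle space `ℱ_n`, the Hilbert space of symmetric wave functions. -/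
def NParticle (d n : ℕ) : Type := symmetric d n

instance (d n : ℕ) : NormedAddCommGroup (NParticle d n) :=
  inferInstanceAs (NormedAddCommGroup (symmetric d n))

instance (d n : ℕ) : InnerProductSpace ℂ (NParticle d n) :=
  inferInstanceAs (InnerProductSpace ℂ (symmetric d n))

instance (d n : ℕ) : CompleteSpace (NParticle d n) :=
  inferInstanceAs (CompleteSpace (symmetric d n))

/-- The bosonic Fock space `ℱ = ⨁ₙ ℱ_n` (Hilbert space direct sum). -/
def Fock (d : ℕ) : Type := lp (fun n : ℕ => NParticle d n) 2

instance (d : ℕ) : NormedAddCommGroup (Fock d) :=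
  inferInstanceAs (NormedAddCommGroup (lp (fun n : ℕ => NParticle d n) 2))

instance (d : ℕ) : InnerProductSpace ℂ (Fock d) :=
  inferInstanceAs (InnerProductSpace ℂ (lp (fun n : ℕ => NParticle d n) 2))

instance (d : ℕ) : CompleteSpace (Fock d) :=
  inferInstanceAs (CompleteSpace (lp (fun n : ℕ => NParticle d n) 2))

/-- The `n`-particle component `ψ_n` of a vector `ψ` of Fock space. -/
def Fock.component {d : ℕ} (n : ℕ) : Fock d →ₗ[ℂ] NParticle d n where
  toFun ψ := (show lp (fun n : ℕ => NParticle d n) 2 from ψ) n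
  map_add' _ _ := rfl
  map_smul' _ _ := rfl

/-- The vector of Fock space with given square summable components. -/
def Fock.mk {d : ℕ} (φ : ∀ n, NParticle d n) (hφ : Memℓp φ 2) : Fock d :=
  (⟨φ, hφ⟩ : lp (fun n : ℕ => NParticle d n) 2)

/-! ### Creation and annihilation operators -/

theorem eLpNorm_tensorFun (d n : ℕ) (f : OneParticle d) (ψ : Tensor d n) :
    eLpNorm (fun x : Fin (n + 1) → Pos d => f (x 0) * ψ (fun i => x i.succ)) 2 volume
      = eLpNorm f 2 volume * eLpNorm ψ 2 volume ∧
    AEStronglyMeasurable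
      (fun x : Fin (n + 1) → Pos d => f (x 0) * ψ (fun i => x i.succ)) volume := by
  have he := volume_preserving_piFinSuccAbove (fun _ : Fin (n + 1) => Pos d) 0
  have hf := (Lp.aestronglyMeasurable f)
  have hψ := (Lp.aestronglyMeasurable ψ)
  have hm : AEStronglyMeasurable (fun z : Pos d × (Fin n → Pos d) => f z.1 * ψ z.2)
      (volume.prod volume) := hf.comp_fst.mul hψ.comp_snd
  have hfun : (fun x : Fin (n + 1) → Pos d => f (x 0) * ψ (fun i => x i.succ))
      = (fun z : Pos d × (Fin n → Pos d) => f z.1 * ψ z.2) ∘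
        (MeasurableEquiv.piFinSuccAbove (fun _ : Fin (n + 1) => Pos d) 0) := by
    funext x
    rfl
  refine ⟨?_, ?_⟩
  · rw [hfun, eLpNorm_comp_measurePreserving hm he]
    rw [eLpNorm_eq_lintegral_rpow_enorm_toReal (by norm_num) (by norm_num),
      eLpNorm_eq_lintegral_rpow_enorm_toReal (by norm_num) (by norm_num),
      eLpNorm_eq_lintegral_rpow_enorm_toReal (by norm_num) (by norm_num),
      ← ENNReal.mul_rpow_of_nonneg _ _ (by norm_num)]
    congr 1
    rw [← lintegral_prod_mul (hf.enorm.pow_const _) (hψ.enorm.pow_const _)]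
    refine lintegral_congr fun z => ?_
    rw [enorm_mul, ENNReal.mul_rpow_of_nonneg _ _ (by norm_num)]
  · rw [hfun]
    exact hm.comp_measurePreserving he

theorem memLp_tensorFun (d n : ℕ) (f : OneParticle d) (ψ : Tensor d n) :
    MemLp (fun x : Fin (n + 1) → Pos d => f (x 0) * ψ (fun i => x i.succ)) 2 volume := by
  obtain ⟨h1, h2⟩ := eLpNorm_tensorFun d n f ψ
  exact ⟨h2, by rw [h1]; exact ENNReal.mul_lt_top (Lp.eLpNorm_lt_top f) (Lp.eLpNorm_lt_top ψ)⟩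

theorem ae_tail {d n : ℕ} {P : (Fin n → Pos d) → Prop} (h : ∀ᵐ y, P y) :
    ∀ᵐ x : Fin (n + 1) → Pos d, P (fun i => x i.succ) := by
  have he := volume_preserving_piFinSuccAbove (fun _ : Fin (n + 1) => Pos d) 0
  exact (Measure.quasiMeasurePreserving_snd.comp he.quasiMeasurePreserving).ae h

/-- `ψ ↦ f ⊗ ψ`, where `(f ⊗ ψ)(x₀, x₁, …, xₙ) = f(x₀) ψ(x₁, …, xₙ)`. -/
def tensorLeft (d n : ℕ) (f : OneParticle d) : Tensor d n →L[ℂ] Tensor d (n + 1) :=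
  LinearMap.mkContinuous
    { toFun := fun ψ => (memLp_tensorFun d n f ψ).toLp _
      map_add' := by
        intro ψ φ
        rw [← MemLp.toLp_add]
        refine MemLp.toLp_congr _ _ ?_
        filter_upwards [ae_tail (Lp.coeFn_add ψ φ)] with x hx
        simp only [hx, Pi.add_apply, mul_add]
      map_smul' := by
        intro c ψ
        rw [RingHom.id_apply, ← MemLp.toLp_const_smul]
        refine MemLp.toLp_congr _ _ ?_
        filter_upwards [ae_tail (Lp.coeFn_smul c ψ)] with x hx
        simp only [hx, Pi.smul_apply, smul_eq_mul]
        ring }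
    ‖f‖ (by
      intro ψ
      simp only [LinearMap.coe_mk, AddHom.coe_mk]
      rw [Lp.norm_toLp, (eLpNorm_tensorFun d n f ψ).1, ENNReal.toReal_mul, Lp.norm_def, Lp.norm_def])

/-- The creation operator `a*(f) : ℱ_n → ℱ_{n+1}`, `a*(f) ψ = √(n+1) S(f ⊗ ψ)`, where `S` is the
orthogonal projection onto the symmetric wave functions. It is linear in `f`. -/
def creationN (d n : ℕ) (f : OneParticle d) : NParticle d n →L[ℂ] NParticle d (n + 1) :=
  (Real.sqrt (n + 1) : ℂ) •
    ((symmetric d (n + 1)).orthogonalProjectionOnto ∘L tensorLeft d n f ∘L (symmetric d n).subtypeL :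
      symmetric d n →L[ℂ] symmetric d (n + 1))

/-- The annihilation operator `a(f) : ℱ_{n+1} → ℱ_n`, the adjoint of `a*(f)`. It is antilinear
in `f`. -/
def annihilationN (d n : ℕ) (f : OneParticle d) : NParticle d (n + 1) →L[ℂ] NParticle d n :=
  ContinuousLinearMap.adjoint (creationN d n f)

/-- The closed, densely defined annihilation operator `a(f)` on Fock space with its natural domain;
`(a(f)ψ)_n = a(f) ψ_{n+1}`. -/
def annihilation (d : ℕ) (f : OneParticle d) : Fock d →ₗ.[ℂ] Fock d where
  domain :=
    { carrier := {ψ | Memℓp (fun n => annihilationN d n f (Fock.component (n + 1) ψ)) 2}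
      add_mem' := by
        intro ψ φ hψ hφ
        have h := Memℓp.add hψ hφ
        simp only [mem_ofPred_eq] at *
        convert h using 2 with n
        simp
      zero_mem' := by
        simp only [mem_ofPred_eq, map_zero]
        exact zero_memℓp
      smul_mem' := by
        intro c ψ hψ
        have h := Memℓp.const_smul hψ c
        simp only [mem_ofPred_eq] at *
        convert h using 2 with n
        simp }
  toFun :=
    { toFun := fun ψ =>
        Fock.mk (fun n => annihilationN d n f (Fock.component (n + 1) ψ.1)) ψ.2
      map_add' := by
        intro ψ φ
        refine Subtype.ext (funext fun n => ?_)
        exact (congrArg (annihilationN d n f) (map_add (Fock.component (n + 1)) ψ.1 φ.1)).trans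
          (map_add (annihilationN d n f) _ _)
      map_smul' := by
        intro c ψ
        refine Subtype.ext (funext fun n => ?_)
        exact (congrArg (annihilationN d n f) (map_smul (Fock.component (n + 1)) c ψ.1)).trans
          (map_smul (annihilationN d n f) _ _) }

/-! ### States -/

/-- The index set of a fixed orthonormal basis of Fock space. -/
def basisIndex (d : ℕ) : Set (Fock d) := (exists_hilbertBasis ℂ (Fock d)).choose

/-- A fixed orthonormal basis of Fock space, used to compute traces of positive operators and of
products of two Hilbert-Schmidt operators; these traces do not depend on it. -/
def basis (d : ℕ) : HilbertBasis (basisIndex d) ℂ (Fock d) :=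
  (exists_hilbertBasis ℂ (Fock d)).choose_spec.choose

/-- A state on Fock space: a density matrix `ρ` (a positive operator of trace one) for which
`Tr ρ a*(f) a(f) = ‖a(f) ρ^{1/2}‖²_{HS}` is finite for every `f ∈ L²(ℝ^d)`. -/
structure FockState (d : ℕ) where
  /-- the density matrix -/
  ρ : Fock d →L[ℂ] Fock d
  nonneg : 0 ≤ ρ
  trace_one : HasSum (fun b => ⟪basis d b, ρ (basis d b)⟫_ℂ) 1
  mem_domain : ∀ f b, CFC.sqrt ρ (basis d b) ∈ (annihilation d f).domain
  finite_occupation : ∀ f,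
    Summable fun b => ‖annihilation d f ⟨CFC.sqrt ρ (basis d b), mem_domain f b⟩‖ ^ 2

/-- The single particle density matrix `f, g ↦ ω(a*(f) a(g)) = Tr ρ a*(f) a(g)`, evaluated as
`Tr (a(f) ρ^{1/2})* (a(g) ρ^{1/2})`. It is linear in `f` and antilinear in `g`. -/
def FockState.corr {d : ℕ} (ω : FockState d) (f g : OneParticle d) : ℂ :=
  ∑' b, ⟪annihilation d f ⟨CFC.sqrt ω.ρ (basis d b), ω.mem_domain f b⟩,
    annihilation d g ⟨CFC.sqrt ω.ρ (basis d b), ω.mem_domain g b⟩⟫_ℂ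

/-- The mean number `ω(a*(f) a(f))` of particles with wave function `f`. -/
def FockState.occupation {d : ℕ} (ω : FockState d) (f : OneParticle d) : ℝ := (ω.corr f f).re

/-! ### Proper condensates -/

/-- The subspace `L²(O)` of functions which vanish almost everywhere outside of `O`. -/
def L2On {d : ℕ} (O : Set (Pos d)) : Set (OneParticle d) := {f | ∀ᵐ x, x ∉ O → f x = 0}

/-- The regular wave functions `R(O)` of a sequence of states: those `f ∈ L²(O)` with
`limsup_{σ → ∞} ω_σ(a*(f) a(f)) < ∞`. -/
def regular {d : ℕ} (ω : ℝ → FockState d) (O : Set (Pos d)) : Set (OneParticle d) :=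
  {f | f ∈ L2On O ∧ limsup (fun σ => ((ω σ).occupation f : EReal)) atTop < ⊤}

/-- The orthogonal complement of `R(O)` in `L²(O)`. -/
def regularCompl {d : ℕ} (ω : ℝ → FockState d) (O : Set (Pos d)) : Set (OneParticle d) :=
  {g | g ∈ L2On O ∧ ∀ f ∈ regular ω O, ⟪f, g⟫_ℂ = 0}

/-- The limit of the sequence contains a proper condensate in `O` with normalized singular wave
function `s`: `R(O)` is closed and its orthogonal complement in `L²(O)` is the ray of `s`. -/
structure IsProperCondensate {d : ℕ} (ω : ℝ → FockState d) (O : Set (Pos d))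
    (s : OneParticle d) : Prop where
  isClosed_regular : IsClosed (regular ω O)
  norm_eq_one : ‖s‖ = 1
  compl_eq : regularCompl ω O = {g | ∃ z : ℂ, g = z • s}

/-- The translations `e^{ixP}`, with `P = -i∇` the momentum operator: `(e^{ixP} f)(u) = f(u + x)`. -/
def momentumShift {d : ℕ} (x : Pos d) : OneParticle d →L[ℂ] OneParticle d :=
  (Lp.compMeasurePreservingₗᵢ ℂ (fun u : Pos d => u + x)
    (measurePreserving_add_right volume x)).toContinuousLinearMap

/-- The sequence describes a homogeneous proper condensate in `O`: for all open `O₀` and all `x`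
such that `O₀` and the translated region supporting the functions `e^{ixP} f`, `f ∈ L²(O₀)`, have
their closures in `O`,
`n_C(σ)⁻¹ ω_σ(a*(e^{ixP} f) a(e^{ixP} g)) → ⟨s, f⟩ ⟨g, s⟩` along the subsequences of `σ` for which
`n_C(σ) = ω_σ(a*(s) a(s))` diverges. -/
structure IsHomogeneousCondensate {d : ℕ} (ω : ℝ → FockState d) (O : Set (Pos d))
    (s : OneParticle d) : Prop extends IsProperCondensate ω O s where
  homogeneous : ∀ u : ℕ → ℝ, Tendsto u atTop atTop →
    Tendsto (fun k => (ω (u k)).occupation s) atTop atTop →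
    ∀ O₀ : Set (Pos d), IsOpen O₀ → closure O₀ ⊆ O →
    ∀ x : Pos d, closure ((fun v => v - x) '' O₀) ⊆ O →
    ∀ f ∈ L2On O₀, ∀ g ∈ L2On O₀,
      Tendsto (fun k => (((ω (u k)).occupation s)⁻¹ : ℂ) *
        (ω (u k)).corr (momentumShift x f) (momentumShift x g)) atTop (𝓝 (⟪s, f⟫_ℂ * ⟪g, s⟫_ℂ))

/-- `n` bounds the occupation numbers of all regular wave functions in the state `ω_σ`:
`ω_σ(a*(f) a(f)) ≤ n ‖f‖²` for `f ∈ R(O)`. -/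
def RegularBound {d : ℕ} (ω : ℝ → FockState d) (O : Set (Pos d)) (n σ : ℝ) : Prop :=
  ∀ f ∈ regular ω O, (ω σ).occupation f ≤ n * ‖f‖ ^ 2

/-! ### Plane waves, Fourier transforms and form factors of balls -/

/-- The function `u ↦ |O|^{-1/2} e^{i k u}` on `O`, extended by zero. -/
def planeWaveFun {d : ℕ} (O : Set (Pos d)) (k : Pos d) : Pos d → ℂ :=
  O.indicator fun u =>
    (((Real.sqrt (volume.real O))⁻¹ : ℝ) : ℂ) * Complex.exp (Complex.I * (⟪k, u⟫_ℝ : ℂ))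

theorem memLp_planeWaveFun {d : ℕ} (c : Pos d) (r : ℝ) (k : Pos d) :
    MemLp (planeWaveFun (Metric.ball c r) k) 2 volume := by
  have hfin : volume (Metric.ball c r) ≠ ⊤ := measure_ball_lt_top.ne
  rw [planeWaveFun, memLp_indicator_iff_restrict measurableSet_ball]
  have : IsFiniteMeasure ((volume : Measure (Pos d)).restrict (Metric.ball c r)) :=
    ⟨by rw [Measure.restrict_apply_univ]; exact hfin.lt_top⟩
  refine MemLp.of_bound (Continuous.aestronglyMeasurable (by fun_prop))
    ((Real.sqrt (volume.real (Metric.ball c r)))⁻¹) (ae_of_all _ fun u => ?_)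
  rw [norm_mul, mul_comm Complex.I, Complex.norm_exp_ofReal_mul_I, mul_one, Complex.norm_real,
    Real.norm_of_nonneg (by positivity)]

/-- The normalized localized plane wave `e_k ∈ L²(O)` in the ball `O` of center `c` and
radius `r`. -/
def planeWave {d : ℕ} (c : Pos d) (r : ℝ) (k : Pos d) : OneParticle d :=
  (memLp_planeWaveFun c r k).toLp _

/-- The Fourier transform `f̃(p) = (2π)^{-d/2} ∫ e^{-i p u} f(u) du` (for integrable `f`). -/
def fourierTransform {d : ℕ} (f : OneParticle d) (p : Pos d) : ℂ :=
  (((2 * Real.pi) ^ (-(d : ℝ) / 2) : ℝ) : ℂ) *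
    ∫ u, Complex.exp (-Complex.I * (⟪p, u⟫_ℝ : ℂ)) * f u

/-- The form factor of the `d`-dimensional ball,
`F_d(t) = ∫_{-1}^1 (1-v²)^{(d-1)/2} cos(tv) dv / ∫_{-1}^1 (1-v²)^{(d-1)/2} dv`,
which equals `Γ(d/2+1) (2/t)^{d/2} J_{d/2}(t)` for `t > 0` by Poisson's integral for the Bessel
function. -/
def formFactor (d : ℕ) (t : ℝ) : ℝ :=
  (∫ v in (-1 : ℝ)..1, (1 - v ^ 2) ^ (((d : ℝ) - 1) / 2) * Real.cos (t * v)) /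
    ∫ v in (-1 : ℝ)..1, (1 - v ^ 2) ^ (((d : ℝ) - 1) / 2)

end BoseGas

end

open BoseGas

noncomputable section

namespace BoseGas

/-! Put `A_σ f = a(f) ρ_σ^{1/2}`, with values in the Hilbert-Schmidt operators. Then `ω_σ(a*(f)
a(g))` is the inner product `⟪A_σ f, A_σ g⟫`, and `A_σ` is a bounded antilinear map, so the claims
become Hilbert space estimates.

Since `R(O)` is closed and its complement in `L²(O)` is `ℂ s`, every `F ∈ L²(O)` is `⟪s, F⟫ s` plus
a regular function, and Banach-Steinhaus on `R(O)` yields the uniform bound `n_R`. Expanding the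
inner product gives the leading term `n_C ⟪s, F⟫ ⟪G, s⟫`; by Cauchy-Schwarz the two cross terms are
of order `√(n_R n_C)` and the regular term of order `n_R` (`norm_corr_sub_le`).

Divided by a diverging `n_C`, the density matrix therefore tends to the projection onto `s`
(`tendsto_corr`). Comparison with the limit prescribed by homogeneity shows that this rank one
kernel is locally translation invariant (`inner_mul_inner`). Differentiating the invariance of its
mollifications gives them a common constant, purely imaginary logarithmic gradient `i p`, so `s` is
a plane wave (`exists_momentum_mollify`, `exists_eq_smul_planeWave`).

Once `s = z e_p`, parts (i) and (ii) are the same estimate (`norm_corr_sub_le_three_mul`). The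
overlap with `s` is a Fourier integral of `f` at `p` in (i), and in (ii) the Fourier transform of
the indicator of a ball, computed by slicing (`integral_ball_exp`). -/

/-! ### Second quantization: the map `f ↦ a(f) ρ^{1/2}` -/

/-- A semilinear map into an `ℓ²` sum with continuous coordinates is continuous. -/
theorem continuous_of_continuous_coord {E ι : Type*} {G : ι → Type*} [NormedAddCommGroup E]
    [NormedSpace ℂ E] [CompleteSpace E] [∀ i, NormedAddCommGroup (G i)] [∀ i, NormedSpace ℂ (G i)]
    (A : E →ₛₗ[starRingEnd ℂ] lp G 2) (h : ∀ i, Continuous fun f => A f i) : Continuous A := by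
  let p : Seminorm ℂ E := (normSeminorm ℂ (lp G 2)).comp A
  -- Closed balls of `ℓ²` are closed under coordinatewise limits, which makes `f ↦ ‖A f‖` lower
  -- semicontinuous; on a Banach space such a seminorm is continuous, by Baire.
  have hp : LowerSemicontinuous p := by
    rw [lowerSemicontinuous_iff_isClosed_preimage]
    intro c
    refine IsSeqClosed.isClosed ?_
    intro u f hu huf
    refine lp.norm_le_of_tendsto (l := atTop) (F := fun k => A (u k))
      (Eventually.of_forall fun k => hu k) ?_
    rw [tendsto_pi_nhds]
    intro i
    exact ((h i).tendsto f).comp huf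
  have hpc : Continuous p := Seminorm.continuous_of_lowerSemicontinuous p hp
  rw [continuous_iff_continuousAt]
  intro f
  rw [ContinuousAt, tendsto_iff_norm_sub_tendsto_zero]
  have h1 : Tendsto (fun g => p (g - f)) (𝓝 f) (𝓝 (p (f - f))) :=
    (hpc.comp (continuous_id.sub continuous_const)).tendsto f
  rw [sub_self, map_zero] at h1
  refine h1.congr fun g => ?_
  change ‖A (g - f)‖ = _
  rw [map_sub]

theorem ae_head {d n : ℕ} {P : Pos d → Prop} (h : ∀ᵐ y, P y) :
    ∀ᵐ x : Fin (n + 1) → Pos d, P (x 0) := by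
  have he := volume_preserving_piFinSuccAbove (fun _ : Fin (n + 1) => Pos d) 0
  exact (Measure.quasiMeasurePreserving_fst.comp he.quasiMeasurePreserving).ae h

theorem tensorLeft_add (d n : ℕ) (f g : OneParticle d) :
    tensorLeft d n (f + g) = tensorLeft d n f + tensorLeft d n g := by
  ext1 ψ
  change (memLp_tensorFun d n (f + g) ψ).toLp _ =
    (memLp_tensorFun d n f ψ).toLp _ + (memLp_tensorFun d n g ψ).toLp _
  rw [← MemLp.toLp_add]
  refine MemLp.toLp_congr _ _ ?_
  filter_upwards [ae_head (Lp.coeFn_add f g)] with x hx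
  simp only [hx, Pi.add_apply, add_mul]

theorem tensorLeft_smul (d n : ℕ) (c : ℂ) (f : OneParticle d) :
    tensorLeft d n (c • f) = c • tensorLeft d n f := by
  ext1 ψ
  change (memLp_tensorFun d n (c • f) ψ).toLp _ = c • (memLp_tensorFun d n f ψ).toLp _
  rw [← MemLp.toLp_const_smul]
  refine MemLp.toLp_congr _ _ ?_
  filter_upwards [ae_head (Lp.coeFn_smul c f)] with x hx
  simp only [hx, Pi.smul_apply, smul_eq_mul, mul_assoc]

theorem norm_tensorLeft_le (d n : ℕ) (f : OneParticle d) : ‖tensorLeft d n f‖ ≤ ‖f‖ :=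
  LinearMap.mkContinuous_norm_le _ (norm_nonneg f) _

theorem creationN_add (d n : ℕ) (f g : OneParticle d) :
    creationN d n (f + g) = creationN d n f + creationN d n g := by
  ext1 ψ
  simp only [creationN, tensorLeft_add]
  rw [ContinuousLinearMap.add_comp, ContinuousLinearMap.comp_add]
  exact congrFun (congrArg DFunLike.coe (smul_add (Real.sqrt (n + 1) : ℂ)
    ((symmetric d (n + 1)).orthogonalProjectionOnto ∘L tensorLeft d n f ∘L
      (symmetric d n).subtypeL)
    ((symmetric d (n + 1)).orthogonalProjectionOnto ∘L tensorLeft d n g ∘L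
      (symmetric d n).subtypeL))) ψ

theorem creationN_smul (d n : ℕ) (c : ℂ) (f : OneParticle d) :
    creationN d n (c • f) = c • creationN d n f := by
  ext1 ψ
  simp only [creationN, tensorLeft_smul]
  rw [ContinuousLinearMap.smul_comp, ContinuousLinearMap.comp_smul]
  exact congrFun (congrArg DFunLike.coe (smul_comm (Real.sqrt (n + 1) : ℂ) c
    ((symmetric d (n + 1)).orthogonalProjectionOnto ∘L tensorLeft d n f ∘L
      (symmetric d n).subtypeL))) ψ

theorem norm_creationN_le (d n : ℕ) (f : OneParticle d) :
    ‖creationN d n f‖ ≤ Real.sqrt (n + 1) * ‖f‖ := by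
  have h : ‖(symmetric d (n + 1)).orthogonalProjectionOnto ∘L tensorLeft d n f ∘L
      (symmetric d n).subtypeL‖ ≤ ‖f‖ := by
    calc _ ≤ ‖(symmetric d (n + 1)).orthogonalProjectionOnto‖ *
          (‖tensorLeft d n f‖ * ‖(symmetric d n).subtypeL‖) :=
          (ContinuousLinearMap.opNorm_comp_le _ _).trans (mul_le_mul_of_nonneg_left
            (ContinuousLinearMap.opNorm_comp_le _ _) (norm_nonneg _))
      _ ≤ 1 * (‖f‖ * 1) := by
          gcongr
          · exact Submodule.orthogonalProjectionOnto_norm_le _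
          · exact norm_tensorLeft_le d n f
          · exact Submodule.norm_subtypeL_le _
      _ = ‖f‖ := by ring
  have h2 : ‖creationN d n f‖ ≤ ‖(Real.sqrt (n + 1) : ℂ)‖ *
      ‖(symmetric d (n + 1)).orthogonalProjectionOnto ∘L tensorLeft d n f ∘L
      (symmetric d n).subtypeL‖ := ContinuousLinearMap.opNorm_smul_le (Real.sqrt (n + 1) : ℂ)
      ((symmetric d (n + 1)).orthogonalProjectionOnto ∘L tensorLeft d n f ∘L
        (symmetric d n).subtypeL)
  rw [Complex.norm_real, Real.norm_of_nonneg (Real.sqrt_nonneg _)] at h2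
  exact h2.trans (mul_le_mul_of_nonneg_left h (Real.sqrt_nonneg _))

theorem annihilationN_add (d n : ℕ) (f g : OneParticle d) :
    annihilationN d n (f + g) = annihilationN d n f + annihilationN d n g := by
  simp only [annihilationN, creationN_add, map_add]

theorem annihilationN_smul (d n : ℕ) (c : ℂ) (f : OneParticle d) :
    annihilationN d n (c • f) = starRingEnd ℂ c • annihilationN d n f := by
  simp only [annihilationN, creationN_smul, map_smulₛₗ]

theorem norm_annihilationN_le (d n : ℕ) (f : OneParticle d) :
    ‖annihilationN d n f‖ ≤ Real.sqrt (n + 1) * ‖f‖ := by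
  rw [annihilationN, LinearIsometryEquiv.norm_map]
  exact norm_creationN_le d n f

/-- The bound `√(n+1) ‖f‖` degenerates as `n` grows, so it gives continuity only sector by sector;
on all of Fock space continuity comes from `continuous_of_continuous_coord`. -/
theorem continuous_annihilationN (d n : ℕ) : Continuous fun f => annihilationN d n f := by
  let A : OneParticle d →ₛₗ[starRingEnd ℂ] (NParticle d (n + 1) →L[ℂ] NParticle d n) :=
    { toFun := annihilationN d n
      map_add' := annihilationN_add d n
      map_smul' := annihilationN_smul d n }
  exact AddMonoidHomClass.continuous_of_bound A (Real.sqrt (n + 1)) (norm_annihilationN_le d n)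

/-- The antilinear map `f ↦ a(f) ψ` for a vector `ψ` in the domain of all `a(f)`. -/
def annihilationOn {d : ℕ} (ψ : Fock d) (hψ : ∀ f, ψ ∈ (annihilation d f).domain) :
    OneParticle d →ₛₗ[starRingEnd ℂ] lp (fun n : ℕ => NParticle d n) 2 where
  toFun f := annihilation d f ⟨ψ, hψ f⟩
  map_add' f g := Subtype.ext <| funext fun n =>
    congrFun (congrArg DFunLike.coe (annihilationN_add d n f g)) (Fock.component (n + 1) ψ)
  map_smul' c f := Subtype.ext <| funext fun n =>
    congrFun (congrArg DFunLike.coe (annihilationN_smul d n c f)) (Fock.component (n + 1) ψ)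

theorem continuous_annihilationOn {d : ℕ} (ψ : Fock d)
    (hψ : ∀ f, ψ ∈ (annihilation d f).domain) : Continuous (annihilationOn ψ hψ) :=
  continuous_of_continuous_coord _ fun n =>
    (continuous_annihilationN d n).clm_apply
      (continuous_const (y := (Fock.component (n + 1) ψ : NParticle d (n + 1))))

/-- The Hilbert space of Hilbert-Schmidt operators on Fock space, each given by the images of the
fixed basis vectors. -/
abbrev HilbertSchmidt (d : ℕ) : Type := lp (fun _ : basisIndex d => Fock d) 2

namespace FockState

variable {d : ℕ} (ω : FockState d)

/-- The antilinear map `f ↦ a(f) ρ^{1/2}`. -/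
def ampₛₗ : OneParticle d →ₛₗ[starRingEnd ℂ] HilbertSchmidt d where
  toFun f := ⟨fun b => annihilation d f ⟨CFC.sqrt ω.ρ (basis d b), ω.mem_domain f b⟩, by
    refine memℓp_gen ?_
    simpa using ω.finite_occupation f⟩
  map_add' f g := Subtype.ext <| funext fun b =>
    (annihilationOn (CFC.sqrt ω.ρ (basis d b)) (fun f => ω.mem_domain f b)).map_add f g
  map_smul' c f := Subtype.ext <| funext fun b =>
    (annihilationOn (CFC.sqrt ω.ρ (basis d b)) (fun f => ω.mem_domain f b)).map_smulₛₗ c f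

/-- The same argument one level up: the coordinates are now the images of the basis vectors. -/
theorem continuous_ampₛₗ : Continuous ω.ampₛₗ :=
  continuous_of_continuous_coord _ fun b =>
    continuous_annihilationOn (CFC.sqrt ω.ρ (basis d b)) (fun f => ω.mem_domain f b)

/-- The bounded antilinear map `f ↦ a(f) ρ^{1/2}`. -/
def amp : OneParticle d →SL[starRingEnd ℂ] HilbertSchmidt d := ⟨ω.ampₛₗ, ω.continuous_ampₛₗ⟩

/-- From here on a state enters only through the Gram form of `amp`. -/
theorem corr_eq_inner (f g : OneParticle d) : ω.corr f g = ⟪ω.amp f, ω.amp g⟫_ℂ := rfl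

theorem occupation_eq (f : OneParticle d) : ω.occupation f = ‖ω.amp f‖ ^ 2 := by
  rw [occupation, corr_eq_inner, inner_self_eq_norm_sq_to_K]
  norm_cast

theorem occupation_nonneg (f : OneParticle d) : 0 ≤ ω.occupation f := by
  rw [occupation_eq]
  positivity

theorem corr_self (f : OneParticle d) : ω.corr f f = ω.occupation f := by
  rw [occupation_eq, corr_eq_inner, inner_self_eq_norm_sq_to_K]
  norm_cast

theorem norm_amp (f : OneParticle d) : ‖ω.amp f‖ = Real.sqrt (ω.occupation f) := by
  rw [occupation_eq, Real.sqrt_sq (norm_nonneg _)]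

end FockState

/-! ### The regular subspace and the singular wave function -/

/-- `S` will be the image of `s`, and `F`, `G` the images of regular parts: the `S`-`S` term is
subtracted and the other three are bounded by Cauchy-Schwarz. -/
theorem norm_inner_add_sub_le {H : Type*} [NormedAddCommGroup H] [InnerProductSpace ℂ H]
    (S F G : H) (a b : ℂ) :
    ‖⟪a • S + F, b • S + G⟫_ℂ - starRingEnd ℂ a * b * ⟪S, S⟫_ℂ‖ ≤
      ‖a‖ * ‖S‖ * ‖G‖ + ‖b‖ * ‖S‖ * ‖F‖ + ‖F‖ * ‖G‖ := by
  have key : ⟪a • S + F, b • S + G⟫_ℂ - starRingEnd ℂ a * b * ⟪S, S⟫_ℂ =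
      starRingEnd ℂ a * ⟪S, G⟫_ℂ + b * ⟪F, S⟫_ℂ + ⟪F, G⟫_ℂ := by
    simp only [inner_add_left, inner_add_right, inner_smul_left, inner_smul_right]
    ring
  rw [key]
  refine norm_add₃_le.trans ?_
  rw [norm_mul, norm_mul, RCLike.norm_conj, mul_assoc, mul_assoc, mul_comm ‖S‖ ‖F‖]
  gcongr <;> exact norm_inner_le_norm _ _

section Condensate

variable {d : ℕ}

/-- `L²(O)` as a subspace of `L²(ℝ^d)`. -/
def l2OnSubmodule (O : Set (Pos d)) : Submodule ℂ (OneParticle d) where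
  carrier := L2On O
  add_mem' := by
    intro f g hf hg
    simp only [L2On, mem_ofPred_eq] at *
    filter_upwards [hf, hg, Lp.coeFn_add f g] with x h1 h2 h3 hx
    rw [h3, Pi.add_apply, h1 hx, h2 hx, add_zero]
  zero_mem' := by
    simp only [L2On, mem_ofPred_eq]
    filter_upwards [Lp.coeFn_zero ℂ 2 (volume : Measure (Pos d))] with x h1 _
    rw [h1, Pi.zero_apply]
  smul_mem' := by
    intro c f hf
    simp only [L2On, mem_ofPred_eq] at *
    filter_upwards [hf, Lp.coeFn_smul c f] with x h1 h3 hx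
    rw [h3, Pi.smul_apply, h1 hx, smul_zero]

theorem limsup_coe_lt_top_iff {α : Type*} {l : Filter α} (u : α → ℝ) :
    limsup (fun a => (u a : EReal)) l < ⊤ ↔ ∃ M : ℝ, ∀ᶠ a in l, u a ≤ M := by
  constructor
  · intro h
    obtain ⟨M, h1, h2⟩ := EReal.lt_iff_exists_real_btwn.1 h
    refine ⟨M, (eventually_lt_of_limsup_lt h1).mono fun a ha => ?_⟩
    exact_mod_cast ha.le
  · rintro ⟨M, hM⟩
    refine lt_of_le_of_lt (limsup_le_of_le (a := (M : EReal)) (h := ?_)) (EReal.coe_lt_top M)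
    filter_upwards [hM] with a ha
    exact_mod_cast ha

theorem mem_regular_iff {ω : ℝ → FockState d} {O : Set (Pos d)} {f : OneParticle d} :
    f ∈ regular ω O ↔ f ∈ L2On O ∧ ∃ M : ℝ, ∀ᶠ σ in atTop, (ω σ).occupation f ≤ M := by
  rw [← limsup_coe_lt_top_iff]
  rfl

/-- The regular wave functions form a subspace. -/
def regularSubmodule (ω : ℝ → FockState d) (O : Set (Pos d)) : Submodule ℂ (OneParticle d) where
  carrier := regular ω O
  add_mem' := by
    intro f g hf hg
    rw [mem_regular_iff] at *
    obtain ⟨hf, M, hM⟩ := hf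
    obtain ⟨hg, N, hN⟩ := hg
    -- The factor 2 comes from `‖a + b‖² ≤ 2 (‖a‖² + ‖b‖²)`.
    refine ⟨(l2OnSubmodule O).add_mem hf hg, 2 * (M + N), ?_⟩
    filter_upwards [hM, hN] with σ h1 h2
    rw [FockState.occupation_eq] at *
    rw [map_add]
    nlinarith [norm_add_le ((ω σ).amp f) ((ω σ).amp g), norm_nonneg ((ω σ).amp f + (ω σ).amp g),
      sq_nonneg (‖(ω σ).amp f‖ - ‖(ω σ).amp g‖)]
  zero_mem' := by
    rw [mem_regular_iff]
    refine ⟨(l2OnSubmodule O).zero_mem, 0, Eventually.of_forall fun σ => ?_⟩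
    rw [FockState.occupation_eq, map_zero, norm_zero]
    norm_num
  smul_mem' := by
    intro c f hf
    rw [mem_regular_iff] at *
    obtain ⟨hf, M, hM⟩ := hf
    refine ⟨(l2OnSubmodule O).smul_mem c hf, ‖c‖ ^ 2 * M, ?_⟩
    filter_upwards [hM] with σ h1
    rw [FockState.occupation_eq] at *
    rw [map_smulₛₗ, norm_smul, RCLike.norm_conj, mul_pow]
    gcongr

variable {ω : ℝ → FockState d} {O : Set (Pos d)} {s : OneParticle d}

namespace IsProperCondensate

theorem mem_compl (h : IsProperCondensate ω O s) : s ∈ regularCompl ω O := by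
  rw [h.compl_eq]
  exact ⟨1, (one_smul ℂ s).symm⟩

theorem mem_l2On (h : IsProperCondensate ω O s) : s ∈ L2On O := h.mem_compl.1

theorem inner_self (h : IsProperCondensate ω O s) : ⟪s, s⟫_ℂ = 1 := by
  rw [inner_self_eq_norm_sq_to_K, h.norm_eq_one]
  norm_num

theorem notMem_regular (h : IsProperCondensate ω O s) : s ∉ regular ω O := by
  intro hs
  have := h.mem_compl.2 s hs
  rw [h.inner_self] at this
  exact one_ne_zero this

/-- An eventually bounded occupation would make `s` regular, hence orthogonal to itself. -/
theorem frequently_lt (h : IsProperCondensate ω O s) (M : ℝ) :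
    ∃ᶠ σ in atTop, M < (ω σ).occupation s := by
  intro hM
  refine h.notMem_regular (mem_regular_iff.2 ⟨h.mem_l2On, M, ?_⟩)
  filter_upwards [hM] with σ hσ
  exact not_lt.1 hσ

/-- A sequence along which the number of particles in the condensate diverges. -/
theorem exists_seq_tendsto (h : IsProperCondensate ω O s) :
    ∃ u : ℕ → ℝ, Tendsto u atTop atTop ∧
      Tendsto (fun k => (ω (u k)).occupation s) atTop atTop := by
  have h1 : ∀ k : ℕ, ∃ σ : ℝ, (k : ℝ) ≤ σ ∧ (k : ℝ) < (ω σ).occupation s := fun k =>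
    frequently_atTop.1 (h.frequently_lt k) k
  choose u hu1 hu2 using h1
  exact ⟨u, tendsto_atTop_mono hu1 tendsto_natCast_atTop_atTop,
    tendsto_atTop_mono (fun k => (hu2 k).le) tendsto_natCast_atTop_atTop⟩

/-- The component orthogonal to `s` of a function in `L²(O)` is regular. -/
theorem sub_mem_regular (h : IsProperCondensate ω O s) {F : OneParticle d} (hF : F ∈ L2On O) :
    F - ⟪s, F⟫_ℂ • s ∈ regular ω O := by
  let K := regularSubmodule ω O
  have : CompleteSpace K := IsClosed.completeSpace_coe (hs := h.isClosed_regular)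
  let P : OneParticle d := K.orthogonalProjectionOnto F
  have hP : P ∈ K := (K.orthogonalProjectionOnto F).2
  -- The residual of the projection onto `R(O)` stays in `L²(O)` and is orthogonal to `R(O)`, so it
  -- is some `z • s`; pairing with `s` identifies `z`.
  have hG : F - P ∈ regularCompl ω O := by
    refine ⟨(l2OnSubmodule O).sub_mem hF (mem_regular_iff.1 hP).1, fun f hf => ?_⟩
    exact Submodule.sub_starProjection_mem_orthogonal (K := K) F f hf
  rw [h.compl_eq] at hG
  obtain ⟨z, hz⟩ := hG
  have hsP : ⟪s, P⟫_ℂ = 0 := by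
    rw [← inner_conj_symm, h.mem_compl.2 P hP, map_zero]
  have hzz : ⟪s, F⟫_ℂ = z := by
    have h1 : F = P + z • s := by rw [← hz]; abel
    rw [h1, inner_add_right, hsP, inner_smul_right, h.inner_self, zero_add, mul_one]
  rw [hzz, ← hz, sub_sub_cancel]
  exact hP

theorem norm_sub_le (h : IsProperCondensate ω O s) (F : OneParticle d) :
    ‖F - ⟪s, F⟫_ℂ • s‖ ≤ ‖F‖ := by
  have h1 : ⟪F - ⟪s, F⟫_ℂ • s, ⟪s, F⟫_ℂ • s⟫_ℂ = 0 := by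
    rw [inner_smul_right, inner_sub_left, inner_smul_left, h.inner_self, mul_one,
      inner_conj_symm, sub_self, mul_zero]
  have h2 := norm_add_sq_eq_norm_sq_add_norm_sq_of_inner_eq_zero _ _ h1
  rw [sub_add_cancel] at h2
  nlinarith [norm_nonneg F, norm_nonneg (F - ⟪s, F⟫_ℂ • s), norm_nonneg (⟪s, F⟫_ℂ • s)]

/-- The uniform boundedness principle for the occupation of regular wave functions. -/
theorem exists_regularBound (h : IsProperCondensate ω O s) :
    ∃ n : ℝ, 0 ≤ n ∧ ∃ σ₀ : ℝ, 0 < σ₀ ∧ ∀ σ, σ₀ ≤ σ → RegularBound ω O n σ := by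
  by_contra! hcon
  -- If no pair `(n, σ₀)` works, the bound `k` fails at some `σ_k ≥ k + 1`; the `+ 1` keeps the
  -- threshold positive, and `σ_k → ∞` makes the maps pointwise bounded on `R(O)`.
  have h1 : ∀ k : ℕ, ∃ σ : ℝ, (k : ℝ) + 1 ≤ σ ∧ ¬ RegularBound ω O k σ := fun k =>
    hcon k (by positivity) (k + 1) (by positivity)
  choose σ hσ hbad using h1
  let K := regularSubmodule ω O
  have : CompleteSpace K := IsClosed.completeSpace_coe (hs := h.isClosed_regular)
  have hσ' : Tendsto σ atTop atTop := tendsto_atTop_mono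
    (fun k => (le_add_of_nonneg_right zero_le_one).trans (hσ k)) tendsto_natCast_atTop_atTop
  obtain ⟨C, hC⟩ := banach_steinhaus (g := fun k : ℕ => (ω (σ k)).amp.comp K.subtypeL) (by
    intro f
    obtain ⟨-, M, hM⟩ := mem_regular_iff.1 f.2
    have hb : IsBoundedUnder (· ≤ ·) atTop
        fun k : ℕ => ‖((ω (σ k)).amp.comp K.subtypeL) f‖ := by
      refine ⟨Real.sqrt M, ?_⟩
      rw [eventually_map]
      filter_upwards [hσ'.eventually hM] with k hk
      change ‖(ω (σ k)).amp f‖ ≤ _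
      rw [FockState.norm_amp]
      exact Real.sqrt_le_sqrt hk
    obtain ⟨C, hC⟩ := hb.bddAbove_range
    exact ⟨C, fun k => hC (mem_range_self k)⟩)
  -- Any index `k ≥ C²` contradicts the choice of `σ_k`.
  obtain ⟨k, hk⟩ := exists_nat_ge (C ^ 2)
  refine hbad k fun f hf => ?_
  have h2 : ‖(ω (σ k)).amp f‖ ≤ C * ‖f‖ :=
    ((ω (σ k)).amp.comp K.subtypeL).le_of_opNorm_le (hC k) ⟨f, hf⟩
  rw [FockState.occupation_eq]
  calc ‖(ω (σ k)).amp f‖ ^ 2 ≤ (C * ‖f‖) ^ 2 := by gcongr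
    _ = C ^ 2 * ‖f‖ ^ 2 := by ring
    _ ≤ k * ‖f‖ ^ 2 := by gcongr

/-- The single particle density matrix is given by the condensate up to terms of the order of
the geometric mean of the occupation numbers. -/
theorem norm_corr_sub_le (h : IsProperCondensate ω O s) {n σ : ℝ} (hn : 0 ≤ n)
    (hR : RegularBound ω O n σ) {F G : OneParticle d} (hF : F ∈ L2On O) (hG : G ∈ L2On O) :
    ‖(ω σ).corr F G - ((ω σ).occupation s : ℂ) * (⟪s, F⟫_ℂ * ⟪G, s⟫_ℂ)‖ ≤
      Real.sqrt (n * (ω σ).occupation s) * (‖⟪s, F⟫_ℂ‖ * ‖G‖ + ‖⟪s, G⟫_ℂ‖ * ‖F‖)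
        + n * ‖F‖ * ‖G‖ := by
  set α := ⟪s, F⟫_ℂ with hα
  set β := ⟪s, G⟫_ℂ with hβ
  have hβ' : ⟪G, s⟫_ℂ = starRingEnd ℂ β := (inner_conj_symm _ _).symm
  set A := (ω σ).amp
  set F' := F - α • s
  set G' := G - β • s
  have amp_le : ∀ {H : OneParticle d}, H ∈ L2On O →
      ‖A (H - ⟪s, H⟫_ℂ • s)‖ ≤ Real.sqrt n * ‖H‖ := by
    intro H hH
    have h1 := hR _ (h.sub_mem_regular hH)
    rw [FockState.norm_amp, Real.sqrt_le_left (by positivity), mul_pow, Real.sq_sqrt hn]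
    refine h1.trans ?_
    have := h.norm_sub_le H
    gcongr
  have hF' : ‖A F'‖ ≤ Real.sqrt n * ‖F‖ := amp_le hF
  have hG' : ‖A G'‖ ≤ Real.sqrt n * ‖G‖ := amp_le hG
  have hAF : A F = starRingEnd ℂ α • A s + A F' := by
    rw [← map_smulₛₗ, ← map_add]; congr 1; simp [F']
  have hAG : A G = starRingEnd ℂ β • A s + A G' := by
    rw [← map_smulₛₗ, ← map_add]; congr 1; simp [G']
  have hss : ⟪A s, A s⟫_ℂ = ((ω σ).occupation s : ℂ) := by
    rw [← FockState.corr_eq_inner, FockState.corr_self]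
  have hs : ‖A s‖ = Real.sqrt ((ω σ).occupation s) := FockState.norm_amp _ _
  -- `A` is antilinear, hence the conjugated coefficients; the inner product, antilinear in its
  -- first slot, turns them back into `α` and the conjugate of `β`.
  have key := norm_inner_add_sub_le (A s) (A F') (A G') (starRingEnd ℂ α) (starRingEnd ℂ β)
  rw [← hAF, ← hAG, hss, hs, Complex.conj_conj, RCLike.norm_conj, RCLike.norm_conj] at key
  have e1 : (ω σ).corr F G - ((ω σ).occupation s : ℂ) * (α * ⟪G, s⟫_ℂ) =
      ⟪A F, A G⟫_ℂ - α * starRingEnd ℂ β * ((ω σ).occupation s : ℂ) := by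
    rw [FockState.corr_eq_inner, hβ', mul_comm ((ω σ).occupation s : ℂ)]
  rw [e1, Real.sqrt_mul hn]
  refine key.trans ?_
  have hy0 := norm_nonneg (A G')
  generalize ‖A F'‖ = x at *
  generalize ‖A G'‖ = y at *
  have hn' := Real.sqrt_nonneg n
  have hy : 0 ≤ Real.sqrt n * ‖F‖ := by positivity
  calc _ ≤ ‖α‖ * Real.sqrt ((ω σ).occupation s) * (Real.sqrt n * ‖G‖) +
        ‖β‖ * Real.sqrt ((ω σ).occupation s) * (Real.sqrt n * ‖F‖) +
        (Real.sqrt n * ‖F‖) * (Real.sqrt n * ‖G‖) :=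
        add_le_add (add_le_add (mul_le_mul_of_nonneg_left hG' (by positivity))
          (mul_le_mul_of_nonneg_left hF' (by positivity)))
          (mul_le_mul hF' hG' hy0 hy)
    _ = Real.sqrt n * Real.sqrt ((ω σ).occupation s) * (‖α‖ * ‖G‖ + ‖β‖ * ‖F‖) +
        (Real.sqrt n * Real.sqrt n) * ‖F‖ * ‖G‖ := by ring
    _ = _ := by rw [Real.mul_self_sqrt hn]

/-- The rescaled single particle density matrix converges to the projection onto `s`. -/
theorem tendsto_corr (h : IsProperCondensate ω O s) {u : ℕ → ℝ} (hu : Tendsto u atTop atTop)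
    (hs : Tendsto (fun k => (ω (u k)).occupation s) atTop atTop) {F G : OneParticle d}
    (hF : F ∈ L2On O) (hG : G ∈ L2On O) :
    Tendsto (fun k => (((ω (u k)).occupation s)⁻¹ : ℂ) * (ω (u k)).corr F G) atTop
      (𝓝 (⟪s, F⟫_ℂ * ⟪G, s⟫_ℂ)) := by
  obtain ⟨n, hn, σ₀, -, hb⟩ := h.exists_regularBound
  rw [tendsto_iff_norm_sub_tendsto_zero]
  set C := ‖⟪s, F⟫_ℂ‖ * ‖G‖ + ‖⟪s, G⟫_ℂ‖ * ‖F‖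
  have hinv : Tendsto (fun k => ((ω (u k)).occupation s)⁻¹) atTop (𝓝 0) :=
    tendsto_inv_atTop_zero.comp hs
  -- After division by `N = n_C`, the cross terms decay like `N^{-1/2}` and the regular term like
  -- `N⁻¹`.
  have hlim : Tendsto (fun k => Real.sqrt n * Real.sqrt ((ω (u k)).occupation s)⁻¹ * C +
      n * ‖F‖ * ‖G‖ * ((ω (u k)).occupation s)⁻¹) atTop (𝓝 0) := by
    have h1 := (((Real.continuous_sqrt.tendsto 0).comp hinv).const_mul (Real.sqrt n)).mul_const C
    have h2 := hinv.const_mul (n * ‖F‖ * ‖G‖)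
    simpa using h1.add h2
  refine squeeze_zero' (Eventually.of_forall fun _ => norm_nonneg _) ?_ hlim
  filter_upwards [hs.eventually_gt_atTop 0, hu.eventually_ge_atTop σ₀] with k hk hσ
  have hest := h.norm_corr_sub_le hn (hb _ hσ) hF hG
  set N := (ω (u k)).occupation s
  have hN : (N : ℂ) ≠ 0 := by exact_mod_cast hk.ne'
  have e : (N : ℂ)⁻¹ * (ω (u k)).corr F G - ⟪s, F⟫_ℂ * ⟪G, s⟫_ℂ =
      (N : ℂ)⁻¹ * ((ω (u k)).corr F G - (N : ℂ) * (⟪s, F⟫_ℂ * ⟪G, s⟫_ℂ)) := by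
    field_simp
  rw [e, norm_mul, norm_inv, Complex.norm_real, Real.norm_of_nonneg hk.le]
  calc _ ≤ N⁻¹ * (Real.sqrt (n * N) * C + n * ‖F‖ * ‖G‖) := by gcongr
    _ = Real.sqrt n * (Real.sqrt N * N⁻¹) * C + n * ‖F‖ * ‖G‖ * N⁻¹ := by
        rw [Real.sqrt_mul hn]; ring
    _ = _ := by
        rw [← div_eq_mul_inv, Real.sqrt_div_self', Real.sqrt_inv, one_div]

end IsProperCondensate

theorem coeFn_momentumShift (x : Pos d) (f : OneParticle d) :
    ⇑(momentumShift x f) =ᵐ[volume] fun u => f (u + x) :=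
  Lp.coeFn_compMeasurePreserving f (measurePreserving_add_right volume x)

theorem norm_momentumShift (x : Pos d) (f : OneParticle d) : ‖momentumShift x f‖ = ‖f‖ :=
  LinearIsometry.norm_map (Lp.compMeasurePreservingₗᵢ ℂ (fun u : Pos d => u + x)
    (measurePreserving_add_right volume x)) f

theorem momentumShift_mem_l2On {O₀ : Set (Pos d)} {x : Pos d} {f : OneParticle d}
    (hf : f ∈ L2On O₀) : momentumShift x f ∈ L2On ((fun v => v - x) '' O₀) := by
  have h1 := (measurePreserving_add_right (volume : Measure (Pos d)) x).quasiMeasurePreserving.ae hf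
  simp only [L2On, mem_ofPred_eq]
  filter_upwards [h1, coeFn_momentumShift x f] with u h2 h3 hu
  rw [h3]
  exact h2 fun hux => hu ⟨u + x, hux, by simp⟩

theorem L2On_mono {O₀ O₁ : Set (Pos d)} (h : O₀ ⊆ O₁) : L2On O₀ ⊆ L2On O₁ := by
  intro f hf
  simp only [L2On, mem_ofPred_eq] at *
  filter_upwards [hf] with x hx hxO using hx fun h' => hxO (h h')

/-- In a homogeneous condensate the projection onto `s` is locally invariant under translations. -/
theorem IsHomogeneousCondensate.inner_mul_inner (h : IsHomogeneousCondensate ω O s)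
    {O₀ : Set (Pos d)} (hO : IsOpen O₀) (hcl : closure O₀ ⊆ O) {x : Pos d}
    (hx : closure ((fun v => v - x) '' O₀) ⊆ O) {f g : OneParticle d} (hf : f ∈ L2On O₀)
    (hg : g ∈ L2On O₀) :
    ⟪s, momentumShift x f⟫_ℂ * ⟪momentumShift x g, s⟫_ℂ = ⟪s, f⟫_ℂ * ⟪g, s⟫_ℂ := by
  obtain ⟨u, hu, hs⟩ := h.toIsProperCondensate.exists_seq_tendsto
  -- Two limits of one sequence: the first from the condensate estimate for the shifted functions,
  -- the second from homogeneity.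
  exact tendsto_nhds_unique
    (h.toIsProperCondensate.tendsto_corr hu hs
      (L2On_mono (subset_closure.trans hx) (momentumShift_mem_l2On hf))
      (L2On_mono (subset_closure.trans hx) (momentumShift_mem_l2On hg)))
    (h.homogeneous u hu hs O₀ hO hcl x hx f hf g hg)

end Condensate

/-! ### The singular wave function of a homogeneous condensate is a plane wave -/

section PlaneWave

variable {d : ℕ}

theorem memLp_bump (φ : ContDiffBump (0 : Pos d)) (a : Pos d) :
    MemLp (fun u => ((φ.normed volume (a - u) : ℝ) : ℂ)) 2 (volume : Measure (Pos d)) := by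
  have hc : Continuous fun u : Pos d => ((φ.normed volume (a - u) : ℝ) : ℂ) :=
    Complex.continuous_ofReal.comp (φ.continuous_normed.comp (continuous_const.sub continuous_id))
  refine hc.memLp_of_hasCompactSupport ?_
  have h1 : HasCompactSupport fun u : Pos d => φ.normed volume (a - u) :=
    φ.hasCompactSupport_normed.comp_homeomorph (Homeomorph.subLeft a)
  exact h1.comp_left Complex.ofReal_zero

/-- The mollifier `u ↦ φ(a - u)` as an element of `L²(ℝ^d)`. -/
def bump (φ : ContDiffBump (0 : Pos d)) (a : Pos d) : OneParticle d := (memLp_bump φ a).toLp _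

theorem coeFn_bump (φ : ContDiffBump (0 : Pos d)) (a : Pos d) :
    ⇑(bump φ a) =ᵐ[volume] fun u => ((φ.normed volume (a - u) : ℝ) : ℂ) :=
  MemLp.coeFn_toLp _

theorem bump_mem_l2On (φ : ContDiffBump (0 : Pos d)) (a : Pos d) :
    bump φ a ∈ L2On (Metric.ball a φ.rOut) := by
  simp only [L2On, mem_ofPred_eq]
  filter_upwards [coeFn_bump φ a] with u hu hout
  rw [hu]
  have h1 : φ.normed volume (a - u) = 0 := by
    rw [← Function.notMem_support, φ.support_normed_eq]
    intro h2
    apply hout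
    rw [Metric.mem_ball, dist_zero_right] at h2
    rwa [Metric.mem_ball, dist_comm, dist_eq_norm]
  rw [h1, Complex.ofReal_zero]

theorem momentumShift_bump (φ : ContDiffBump (0 : Pos d)) (a x : Pos d) :
    momentumShift x (bump φ a) = bump φ (a - x) := by
  refine Lp.ext ?_
  have h1 := (measurePreserving_add_right (volume : Measure (Pos d)) x).quasiMeasurePreserving.ae
    (coeFn_bump φ a)
  filter_upwards [coeFn_momentumShift x (bump φ a), coeFn_bump φ (a - x), h1] with u h2 h3 h4
  rw [h2, h3, h4, sub_sub, add_comm x u]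

/-- The mollification of a function in `L²`. -/
def mollify (φ : ContDiffBump (0 : Pos d)) (s : OneParticle d) (a : Pos d) : ℂ := ⟪bump φ a, s⟫_ℂ

/-- The inner product form suits the translation identity; the convolution form supplies smoothness
and almost everywhere convergence. -/
theorem mollify_eq_convolution (φ : ContDiffBump (0 : Pos d)) (s : OneParticle d) :
    mollify φ s = convolution (φ.normed volume) s (ContinuousLinearMap.lsmul ℝ ℝ) volume := by
  funext a
  rw [mollify, convolution_eq_swap, L2.inner_def]
  refine integral_congr_ae ?_
  filter_upwards [coeFn_bump φ a] with u hu
  rw [hu, RCLike.inner_apply]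
  simp [mul_comm]

theorem locallyIntegrable_oneParticle (s : OneParticle d) :
    LocallyIntegrable s (volume : Measure (Pos d)) :=
  (Lp.memLp s).locallyIntegrable (by norm_num)

theorem differentiable_mollify (φ : ContDiffBump (0 : Pos d)) (s : OneParticle d) :
    Differentiable ℝ (mollify φ s) := by
  rw [mollify_eq_convolution]
  exact (HasCompactSupport.contDiff_convolution_left (n := 1) _ φ.hasCompactSupport_normed
    φ.contDiff_normed (locallyIntegrable_oneParticle s)).differentiable (by norm_num)

variable {ω : ℝ → FockState d} {s : OneParticle d} {c : Pos d} {r : ℝ}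

theorem closure_ball_subset_ball {a : Pos d} {ε : ℝ} (h : a ∈ Metric.ball c (r - ε)) :
    closure (Metric.ball a ε) ⊆ Metric.ball c r := by
  refine Metric.closure_ball_subset_closedBall.trans (Metric.closedBall_subset_ball' ?_)
  rw [Metric.mem_ball] at h
  linarith

/-- The region `O₀` in the homogeneity condition need not be connected. Taking the union of two
small balls compares mollifiers of different widths at independent points `a` and `b`; the shift is
`-x` because `e^{ixP}` moves a bump from `a` to `a - x`. -/
theorem IsHomogeneousCondensate.mollify_mul_mollify
    (h : IsHomogeneousCondensate ω (Metric.ball c r) s) (φ ψ : ContDiffBump (0 : Pos d))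
    {a b x : Pos d} (ha : a ∈ Metric.ball c (r - φ.rOut)) (hb : b ∈ Metric.ball c (r - ψ.rOut))
    (hax : a + x ∈ Metric.ball c (r - φ.rOut)) (hbx : b + x ∈ Metric.ball c (r - ψ.rOut)) :
    starRingEnd ℂ (mollify φ s (a + x)) * mollify ψ s (b + x) =
      starRingEnd ℂ (mollify φ s a) * mollify ψ s b := by
  have himg : (fun v => v - -x) '' (Metric.ball a φ.rOut ∪ Metric.ball b ψ.rOut) =
      Metric.ball (a + x) φ.rOut ∪ Metric.ball (b + x) ψ.rOut := by
    simp [image_union]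
  have key := h.inner_mul_inner (O₀ := Metric.ball a φ.rOut ∪ Metric.ball b ψ.rOut)
    (Metric.isOpen_ball.union Metric.isOpen_ball)
    (by rw [closure_union]
        exact union_subset (closure_ball_subset_ball ha) (closure_ball_subset_ball hb))
    (x := -x)
    (by rw [himg, closure_union]
        exact union_subset (closure_ball_subset_ball hax) (closure_ball_subset_ball hbx))
    (L2On_mono subset_union_left (bump_mem_l2On φ a))
    (L2On_mono subset_union_right (bump_mem_l2On ψ b))
  rw [momentumShift_bump, momentumShift_bump, sub_neg_eq_add, sub_neg_eq_add] at key
  simp only [mollify, inner_conj_symm]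
  exact key

/-- The product in `mollify_mul_mollify` is constant for `x = t v` with small `t`; this is its
derivative at `t = 0`. -/
theorem IsHomogeneousCondensate.fderiv_mollify
    (h : IsHomogeneousCondensate ω (Metric.ball c r) s) (φ ψ : ContDiffBump (0 : Pos d))
    {a b : Pos d} (ha : a ∈ Metric.ball c (r - φ.rOut)) (hb : b ∈ Metric.ball c (r - ψ.rOut))
    (v : Pos d) :
    starRingEnd ℂ (mollify φ s a) * fderiv ℝ (mollify ψ s) b v +
      starRingEnd ℂ (fderiv ℝ (mollify φ s) a v) * mollify ψ s b = 0 := by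
  have hline : ∀ (θ : ContDiffBump (0 : Pos d)) (y : Pos d),
      HasDerivAt (fun t : ℝ => mollify θ s (y + t • v)) (fderiv ℝ (mollify θ s) y v) 0 := by
    intro θ y
    have h1 : HasDerivAt (fun t : ℝ => y + t • v) v 0 := by
      simpa using ((hasDerivAt_id (0 : ℝ)).smul_const v).const_add y
    have h2 : HasFDerivAt (mollify θ s) (fderiv ℝ (mollify θ s) y) (y + (0 : ℝ) • v) := by
      rw [zero_smul, add_zero]
      exact (differentiable_mollify θ s y).hasFDerivAt
    exact h2.comp_hasDerivAt 0 h1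
  have hnear : ∀ {y : Pos d} {ε : ℝ}, y ∈ Metric.ball c ε →
      ∀ᶠ t : ℝ in 𝓝 0, y + t • v ∈ Metric.ball c ε := by
    intro y ε hy
    have hcont : Continuous fun t : ℝ => y + t • v := by fun_prop
    exact hcont.continuousAt.eventually_mem (Metric.isOpen_ball.mem_nhds (by simpa using hy))
  have hprod := ((Complex.conjCLE.toContinuousLinearMap.hasFDerivAt).comp_hasDerivAt (0 : ℝ)
    (hline φ a)).mul (hline ψ b)
  have hconst : HasDerivAt (fun _ : ℝ => starRingEnd ℂ (mollify φ s a) * mollify ψ s b) 0 0 :=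
    hasDerivAt_const _ _
  have heq := hprod.unique (hconst.congr_of_eventuallyEq (by
    filter_upwards [hnear ha, hnear hb] with t h1 h2
    exact h.mollify_mul_mollify φ ψ ha hb h1 h2))
  rw [add_comm]
  simpa using heq

/-- The mollified singular wave functions are plane waves with a common momentum. -/
theorem IsHomogeneousCondensate.exists_momentum_mollify
    (h : IsHomogeneousCondensate ω (Metric.ball c r) s) {φ : ContDiffBump (0 : Pos d)}
    {a : Pos d} (ha : a ∈ Metric.ball c (r - φ.rOut)) (hne : mollify φ s a ≠ 0) :
    ∃ p : Pos d, ∀ ψ : ContDiffBump (0 : Pos d), ∃ K : ℂ, ∀ b ∈ Metric.ball c (r - ψ.rOut),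
      mollify ψ s b = K * Complex.exp (Complex.I * (⟪p, b⟫_ℝ : ℂ)) := by
  -- The momentum is the imaginary part of the logarithmic gradient of one mollification at one
  -- point where it does not vanish.
  let p : Pos d := (InnerProductSpace.toDual ℝ (Pos d)).symm
    (Complex.imCLM.comp ((mollify φ s a)⁻¹ • fderiv ℝ (mollify φ s) a))
  have hp : ∀ v, ⟪p, v⟫_ℝ = ((mollify φ s a)⁻¹ * fderiv ℝ (mollify φ s) a v).im := fun v => by
    rw [InnerProductSpace.toDual_symm_apply]
    rfl
  have hconj : starRingEnd ℂ (mollify φ s a) ≠ 0 := by simpa using hne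
  -- The choice `ψ = φ`, `b = a` says that the modulus is stationary, so the logarithmic gradient is
  -- purely imaginary.
  have hre : ∀ v, ((mollify φ s a)⁻¹ * fderiv ℝ (mollify φ s) a v).re = 0 := by
    intro v
    have h1 := h.fderiv_mollify φ φ ha ha v
    set w := (mollify φ s a)⁻¹ * fderiv ℝ (mollify φ s) a v with hw
    have h2 : fderiv ℝ (mollify φ s) a v = mollify φ s a * w := by
      rw [hw, mul_inv_cancel_left₀ hne]
    rw [h2, map_mul] at h1
    have h3 : starRingEnd ℂ (mollify φ s a) * mollify φ s a * (w + starRingEnd ℂ w) = 0 := by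
      rw [← h1]; ring
    have h4 := (mul_eq_zero.1 h3).resolve_left (mul_ne_zero hconj hne)
    rw [Complex.add_conj] at h4
    have h5 : 2 * w.re = 0 := by exact_mod_cast h4
    linarith
  have hlog : ∀ v, (mollify φ s a)⁻¹ * fderiv ℝ (mollify φ s) a v =
      Complex.I * (⟪p, v⟫_ℝ : ℂ) := by
    intro v
    apply Complex.ext
    · rw [hre]; simp
    · rw [hp]; simp
  refine ⟨p, fun ψ => ?_⟩
  -- With `φ` and `a` kept fixed, the same `p` serves every `ψ` and every `b`.
  have hderiv : ∀ b ∈ Metric.ball c (r - ψ.rOut), ∀ v,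
      fderiv ℝ (mollify ψ s) b v = Complex.I * (⟪p, v⟫_ℝ : ℂ) * mollify ψ s b := by
    intro b hb v
    have h1 := h.fderiv_mollify φ ψ ha hb v
    have h2 : fderiv ℝ (mollify φ s) a v = mollify φ s a * (Complex.I * (⟪p, v⟫_ℝ : ℂ)) := by
      rw [← hlog, mul_inv_cancel_left₀ hne]
    rw [h2, map_mul, map_mul, Complex.conj_I, Complex.conj_ofReal] at h1
    have h3 : starRingEnd ℂ (mollify φ s a) * (fderiv ℝ (mollify ψ s) b v -
        Complex.I * (⟪p, v⟫_ℝ : ℂ) * mollify ψ s b) = 0 := by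
      rw [← h1]; ring
    exact sub_eq_zero.1 ((mul_eq_zero.1 h3).resolve_left hconj)
  have hexp : ∀ b : Pos d, HasFDerivAt (fun y : Pos d => Complex.exp (-(Complex.I *
      (⟪p, y⟫_ℝ : ℂ)))) (Complex.exp (-(Complex.I * (⟪p, b⟫_ℝ : ℂ))) •
      (-(Complex.I • Complex.ofRealCLM.comp (innerSL ℝ p)))) b := by
    intro b
    exact ((Complex.ofRealCLM.hasFDerivAt.comp b (innerSL ℝ p).hasFDerivAt).const_smul
      Complex.I).neg.cexp
  have hprod : ∀ b ∈ Metric.ball c (r - ψ.rOut), HasFDerivAt (fun y : Pos d =>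
      mollify ψ s y * Complex.exp (-(Complex.I * (⟪p, y⟫_ℝ : ℂ)))) (0 : Pos d →L[ℝ] ℂ) b := by
    intro b hb
    refine ((differentiable_mollify ψ s b).hasFDerivAt.mul (hexp b)).congr_fderiv ?_
    ext v
    simp [hderiv b hb v]
    ring
  obtain ⟨K, hK⟩ := Metric.isOpen_ball.exists_is_const_of_fderiv_eq_zero
    (convex_ball c (r - ψ.rOut)).isPreconnected
    (fun b hb => (hprod b hb).differentiableAt.differentiableWithinAt)
    (fun b hb => (hprod b hb).fderiv)
  refine ⟨K, fun b hb => ?_⟩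
  rw [← hK b hb, mul_assoc, ← Complex.exp_add, neg_add_cancel, Complex.exp_zero, mul_one]

/-- Mollifiers with shrinking supports. -/
def mollifierSeq (d n : ℕ) : ContDiffBump (0 : Pos d) where
  rIn := 1 / ((n : ℝ) + 1) / 2
  rOut := 1 / ((n : ℝ) + 1)
  rIn_pos := by positivity
  rIn_lt_rOut := half_lt_self (by positivity)

theorem tendsto_rOut_mollifierSeq (d : ℕ) :
    Tendsto (fun n => (mollifierSeq d n).rOut) atTop (𝓝 0) :=
  tendsto_one_div_add_atTop_nhds_zero_nat

theorem ae_tendsto_mollify (s : OneParticle d) :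
    ∀ᵐ x, Tendsto (fun n => mollify (mollifierSeq d n) s x) atTop (𝓝 (s x)) := by
  simp only [mollify_eq_convolution]
  -- `K = 2` is the fixed ratio of outer to inner radius in `mollifierSeq`.
  refine ContDiffBump.ae_convolution_tendsto_right_of_locallyIntegrable (K := 2)
    (tendsto_rOut_mollifierSeq d) (Eventually.of_forall fun n => ?_)
    (locallyIntegrable_oneParticle s)
  change 1 / ((n : ℝ) + 1) ≤ 2 * (1 / ((n : ℝ) + 1) / 2)
  linarith

theorem eventually_mem_ball_mollifierSeq {x : Pos d} (hx : x ∈ Metric.ball c r) :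
    ∀ᶠ n in atTop, x ∈ Metric.ball c (r - (mollifierSeq d n).rOut) := by
  rw [Metric.mem_ball] at hx
  filter_upwards [(tendsto_rOut_mollifierSeq d).eventually_lt_const (sub_pos.2 hx)] with n hn
  rw [Metric.mem_ball]
  linarith

theorem IsHomogeneousCondensate.exists_ae_eq_exp
    (h : IsHomogeneousCondensate ω (Metric.ball c r) s) (hr : 0 < r) :
    ∃ (p : Pos d) (K : ℂ), ∀ᵐ x, x ∈ Metric.ball c r →
      s x = K * Complex.exp (Complex.I * (⟪p, x⟫_ℝ : ℂ)) := by
  have hs0 : s ≠ 0 := by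
    intro h0
    have := h.norm_eq_one
    rw [h0, norm_zero] at this
    exact zero_ne_one this
  obtain ⟨m, a, ha, hne⟩ : ∃ m a, a ∈ Metric.ball c (r - (mollifierSeq d m).rOut) ∧
      mollify (mollifierSeq d m) s a ≠ 0 := by
    by_contra! hcon
    refine hs0 ((Lp.eq_zero_iff_ae_eq_zero).2 ?_)
    filter_upwards [h.mem_l2On, ae_tendsto_mollify s] with x h1 h2
    by_cases hx : x ∈ Metric.ball c r
    · refine tendsto_nhds_unique h2 ((tendsto_const_nhds (x := (0 : ℂ))).congr' ?_)
      filter_upwards [eventually_mem_ball_mollifierSeq hx] with n hn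
      exact (hcon n x hn).symm
    · exact h1 hx
  obtain ⟨p, hp⟩ := h.exists_momentum_mollify ha hne
  choose K hK using fun n => hp (mollifierSeq d n)
  have hlim : ∀ᵐ x, x ∈ Metric.ball c r →
      Tendsto K atTop (𝓝 (s x * Complex.exp (-(Complex.I * (⟪p, x⟫_ℝ : ℂ))))) := by
    filter_upwards [ae_tendsto_mollify s] with x h2 hx
    refine (h2.mul_const _).congr' ?_
    filter_upwards [eventually_mem_ball_mollifierSeq hx] with n hn
    rw [hK n x hn, mul_assoc, ← Complex.exp_add, add_neg_cancel, Complex.exp_zero, mul_one]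
  -- The amplitudes `K n` do not depend on the point, so convergence at one point of the ball (which
  -- has positive measure) fixes the limit at almost all others.
  obtain ⟨x₀, hx₀, hKx₀⟩ : ∃ x₀ ∈ Metric.ball c r,
      Tendsto K atTop (𝓝 (s x₀ * Complex.exp (-(Complex.I * (⟪p, x₀⟫_ℝ : ℂ))))) := by
    by_contra! hcon
    refine (Metric.measure_ball_pos (volume : Measure (Pos d)) c hr).ne' ?_
    refine measure_mono_null (fun x hx => ?_) hlim
    exact fun h' => hcon x hx (h' hx)
  refine ⟨p, s x₀ * Complex.exp (-(Complex.I * (⟪p, x₀⟫_ℝ : ℂ))), ?_⟩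
  filter_upwards [hlim] with x hx hxb
  rw [tendsto_nhds_unique hKx₀ (hx hxb), mul_assoc, ← Complex.exp_add, neg_add_cancel,
    Complex.exp_zero, mul_one]

end PlaneWave

/-! ### The form factor of a ball -/

section FormFactor

/-- The weight `(1 - v²)^{(d-1)/2}`, proportional to the volume of the slice of the unit ball at
height `v`. -/
def sliceWeight (d : ℕ) (v : ℝ) : ℝ := (1 - v ^ 2) ^ (((d : ℝ) - 1) / 2)

theorem formFactor_eq (d : ℕ) (t : ℝ) :
    formFactor d t = (∫ v in (-1 : ℝ)..1, sliceWeight d v * Real.cos (t * v)) /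
      ∫ v in (-1 : ℝ)..1, sliceWeight d v := rfl

variable {d : ℕ}

theorem sliceWeight_exponent_nonneg (hd : 1 ≤ d) : 0 ≤ ((d : ℝ) - 1) / 2 := by
  have : (1 : ℝ) ≤ d := by exact_mod_cast hd
  linarith

theorem continuous_sliceWeight (hd : 1 ≤ d) : Continuous (sliceWeight d) :=
  Continuous.rpow_const (by fun_prop) fun _ => Or.inr (sliceWeight_exponent_nonneg hd)

theorem sliceWeight_nonneg {v : ℝ} (hv : v ∈ Icc (-1 : ℝ) 1) : 0 ≤ sliceWeight d v :=
  Real.rpow_nonneg (by nlinarith [hv.1, hv.2]) _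

theorem sliceWeight_pos {v : ℝ} (hv : v ∈ Ioo (-1 : ℝ) 1) : 0 < sliceWeight d v :=
  Real.rpow_pos_of_pos (by nlinarith [hv.1, hv.2]) _

theorem sliceWeight_neg (v : ℝ) : sliceWeight d (-v) = sliceWeight d v := by
  rw [sliceWeight, sliceWeight, neg_sq]

theorem sliceWeight_zero : sliceWeight d 0 = 1 := by
  rw [sliceWeight]
  norm_num

theorem integral_sliceWeight_pos (hd : 1 ≤ d) : 0 < ∫ v in (-1 : ℝ)..1, sliceWeight d v :=
  intervalIntegral.intervalIntegral_pos_of_pos_on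
    ((continuous_sliceWeight hd).intervalIntegrable _ _) (fun _ hv => sliceWeight_pos hv)
    (by norm_num)

theorem formFactor_zero (hd : 1 ≤ d) : formFactor d 0 = 1 := by
  rw [formFactor_eq]
  simp only [zero_mul, Real.cos_zero, mul_one]
  exact div_self (integral_sliceWeight_pos hd).ne'

/-- The comparison `|cos| ≤ 1` under a nonnegative continuous weight needs to be strict at one point
only: `v = 0` for the lower bound, and for the upper bound a `v` with `0 < t v ≤ 1 < π`. -/
theorem abs_formFactor_lt_one (hd : 1 ≤ d) {t : ℝ} (ht : 0 < t) : |formFactor d t| < 1 := by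
  have hw := continuous_sliceWeight hd
  have hpos := integral_sliceWeight_pos hd
  have hwc : Continuous fun v => sliceWeight d v * Real.cos (t * v) := hw.mul (by fun_prop)
  rw [formFactor_eq, abs_div, abs_of_pos hpos, div_lt_one hpos, abs_lt]
  constructor
  · rw [← intervalIntegral.integral_neg]
    refine intervalIntegral.integral_lt_integral_of_continuousOn_of_le_of_exists_lt (by norm_num)
      hw.neg.continuousOn hwc.continuousOn (fun v hv => ?_) ⟨0, by norm_num, ?_⟩
    · have h1 := sliceWeight_nonneg (d := d) (Ioc_subset_Icc_self hv)
      nlinarith [Real.neg_one_le_cos (t * v)]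
    · rw [sliceWeight_zero, mul_zero, Real.cos_zero]
      norm_num
  · refine intervalIntegral.integral_lt_integral_of_continuousOn_of_le_of_exists_lt (by norm_num)
      hwc.continuousOn hw.continuousOn (fun v hv => ?_) ?_
    · have h1 := sliceWeight_nonneg (d := d) (Ioc_subset_Icc_self hv)
      nlinarith [Real.cos_le_one (t * v)]
    · have hv0 : 0 < min (1 / 2) (1 / t) := by positivity
      have hv1 : min (1 / 2) (1 / t) ≤ 1 / 2 := min_le_left _ _
      have hv2 : t * min (1 / 2) (1 / t) ≤ 1 :=
        (mul_le_mul_of_nonneg_left (min_le_right _ _) ht.le).trans_eq (mul_one_div_cancel ht.ne')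
      refine ⟨min (1 / 2) (1 / t), ⟨by linarith, by linarith⟩, ?_⟩
      refine mul_lt_of_lt_one_right (sliceWeight_pos ⟨by linarith, by linarith⟩) ?_
      have hlt := Real.cos_lt_cos_of_nonneg_of_le_pi le_rfl
        (hv2.trans (by linarith [Real.pi_gt_three])) (mul_pos ht hv0)
      rwa [Real.cos_zero] at hlt

theorem integral_even_eq {f : ℝ → ℝ} (hf : Continuous f) (he : ∀ v, f (-v) = f v) :
    ∫ v in (-1 : ℝ)..1, f v = 2 * ∫ v in (0 : ℝ)..1, f v := by
  rw [← intervalIntegral.integral_add_adjacent_intervals (hf.intervalIntegrable (-1) 0)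
    (hf.intervalIntegrable 0 1), two_mul]
  congr 1
  have h1 := intervalIntegral.integral_comp_neg (a := 0) (b := 1) f
  simp only [he, neg_zero] at h1
  exact h1.symm

/-- On `[0, 1]` one has `1 - v² ≥ (1 - v)²`, so the weight dominates `(1 - v)^(d-1)`, whose integral
is `1/d`. -/
theorem two_div_le_integral_sliceWeight (hd : 1 ≤ d) :
    2 / (d : ℝ) ≤ ∫ v in (-1 : ℝ)..1, sliceWeight d v := by
  rw [integral_even_eq (continuous_sliceWeight hd) sliceWeight_neg]
  have h1 : ∫ v in (0 : ℝ)..1, (1 - v) ^ (d - 1) = 1 / d := by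
    rw [intervalIntegral.integral_comp_sub_left (fun v => v ^ (d - 1)) 1]
    rw [integral_pow, Nat.cast_sub hd]
    simp [Nat.sub_add_cancel hd, Nat.one_le_iff_ne_zero.1 hd]
  have h2 : ∫ v in (0 : ℝ)..1, (1 - v) ^ (d - 1) ≤ ∫ v in (0 : ℝ)..1, sliceWeight d v := by
    refine intervalIntegral.integral_mono_on (by norm_num)
      (Continuous.intervalIntegrable (by fun_prop) _ _)
      ((continuous_sliceWeight hd).intervalIntegrable _ _) fun v hv => ?_
    have hv' : 0 ≤ 1 - v := by linarith [hv.2]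
    have e : (1 - v) ^ (d - 1) = ((1 - v) ^ 2) ^ (((d : ℝ) - 1) / 2) := by
      rw [← Real.rpow_natCast, ← Real.rpow_natCast, ← Real.rpow_mul hv', Nat.cast_sub hd]
      congr 1
      push_cast
      ring
    rw [e, sliceWeight]
    exact Real.rpow_le_rpow (by positivity) (by nlinarith [hv.1, hv.2])
      (sliceWeight_exponent_nonneg hd)
  rw [h1] at h2
  calc 2 / (d : ℝ) = 2 * (1 / d) := by ring
    _ ≤ _ := by linarith

theorem hasDerivAt_sliceWeight {v : ℝ} (hv : v ∈ Ioo (0 : ℝ) 1) :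
    HasDerivAt (sliceWeight d)
      (-(2 * v) * (((d : ℝ) - 1) / 2) * (1 - v ^ 2) ^ (((d : ℝ) - 1) / 2 - 1)) v := by
  have h1 : HasDerivAt (fun v : ℝ => 1 - v ^ 2) (-(2 * v)) v := by
    simpa using (hasDerivAt_pow 2 v).const_sub 1
  exact h1.rpow_const (Or.inl (by nlinarith [hv.1, hv.2]))

/-- Integration by parts: the boundary term contributes at most `w(1)/t`, and the weight decreases
from 1 to `w(1)`, so the remaining integral is at most `(1 - w(1))/t`. The boundary term must be
kept, since `w(1) = 1` when `d = 1`. -/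
theorem abs_integral_sliceWeight_mul_cos_le (hd : 1 ≤ d) {t : ℝ} (ht : 0 < t) :
    |∫ v in (0 : ℝ)..1, sliceWeight d v * Real.cos (t * v)| ≤ 1 / t := by
  set w' : ℝ → ℝ := fun v =>
    -(2 * v) * (((d : ℝ) - 1) / 2) * (1 - v ^ 2) ^ (((d : ℝ) - 1) / 2 - 1) with hw'
  have hw := continuous_sliceWeight hd
  have hder : ∀ v ∈ Ioo (0 : ℝ) 1, HasDerivAt (sliceWeight d) (w' v) v := fun v hv =>
    hasDerivAt_sliceWeight hv
  have hneg : ∀ v ∈ Icc (0 : ℝ) 1, w' v ≤ 0 := by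
    intro v hv
    have h1 : 0 ≤ (1 - v ^ 2) ^ (((d : ℝ) - 1) / 2 - 1) :=
      Real.rpow_nonneg (by nlinarith [hv.1, hv.2]) _
    have h2 := mul_nonneg (mul_nonneg (mul_nonneg zero_le_two hv.1)
      (sliceWeight_exponent_nonneg hd)) h1
    simp only [hw']
    linarith
  -- For `d = 2` the derivative is unbounded at `v = 1`; its constant sign and the continuity of the
  -- weight still make it integrable.
  have hint : IntervalIntegrable (fun v => -w' v) volume 0 1 := by
    rw [intervalIntegrable_iff_integrableOn_Ioc_of_le zero_le_one]
    exact intervalIntegral.integrableOn_deriv_of_nonneg hw.neg.continuousOn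
      (fun v hv => (hder v hv).neg)
      (fun v hv => neg_nonneg.2 (hneg v (Ioo_subset_Icc_self hv)))
  have hint' : IntervalIntegrable w' volume 0 1 := by
    simpa only [Pi.neg_def, neg_neg] using hint.neg
  have hsin : ∀ v : ℝ, HasDerivAt (fun v => Real.sin (t * v) / t) (Real.cos (t * v)) v := by
    intro v
    have h1 : HasDerivAt (fun v : ℝ => t * v) t v := by simpa using (hasDerivAt_id v).const_mul t
    have h2 := (h1.sin).div_const t
    rwa [mul_div_cancel_right₀ _ ht.ne'] at h2
  have hsc : Continuous fun v => Real.sin (t * v) / t := by fun_prop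
  have hparts := intervalIntegral.integral_mul_deriv_eq_deriv_mul_of_hasDerivAt (a := 0) (b := 1)
    hw.continuousOn hsc.continuousOn (by simpa using hder) (fun v _ => hsin v) hint'
    (Continuous.intervalIntegrable (by fun_prop) _ _)
  have hFTC : ∫ v in (0 : ℝ)..1, -w' v = 1 - sliceWeight d 1 := by
    rw [intervalIntegral.integral_neg, intervalIntegral.integral_eq_sub_of_hasDerivAt_of_le
      zero_le_one hw.continuousOn hder hint', sliceWeight_zero]
    ring
  have habs : ∀ v, |Real.sin (t * v) / t| ≤ 1 / t := fun v => by
    rw [abs_div, abs_of_pos ht]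
    exact div_le_div_of_nonneg_right (Real.abs_sin_le_one _) ht.le
  have hbound : ‖∫ v in (0 : ℝ)..1, w' v * (Real.sin (t * v) / t)‖ ≤
      ∫ v in (0 : ℝ)..1, -w' v * (1 / t) := by
    refine intervalIntegral.norm_integral_le_of_norm_le zero_le_one
      (Eventually.of_forall fun v hv => ?_) (hint.mul_const _)
    rw [Real.norm_eq_abs, abs_mul, abs_of_nonpos (hneg v (Ioc_subset_Icc_self hv))]
    exact mul_le_mul_of_nonneg_left (habs v)
      (neg_nonneg.2 (hneg v (Ioc_subset_Icc_self hv)))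
  rw [intervalIntegral.integral_mul_const, hFTC, Real.norm_eq_abs] at hbound
  have hw1 : 0 ≤ sliceWeight d 1 := sliceWeight_nonneg (by norm_num)
  rw [hparts, mul_zero, Real.sin_zero, zero_div, mul_zero, sub_zero]
  calc _ ≤ |sliceWeight d 1 * (Real.sin (t * 1) / t)| +
        |∫ v in (0 : ℝ)..1, w' v * (Real.sin (t * v) / t)| := abs_sub _ _
    _ ≤ sliceWeight d 1 * (1 / t) + (1 - sliceWeight d 1) * (1 / t) := by
        refine add_le_add ?_ hbound
        rw [abs_mul, abs_of_nonneg hw1]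
        exact mul_le_mul_of_nonneg_left (habs 1) hw1
    _ = 1 / t := by ring

theorem abs_formFactor_le (hd : 1 ≤ d) {t : ℝ} (ht : 0 < t) : |formFactor d t| ≤ d / t := by
  have hd' : (0 : ℝ) < d := by exact_mod_cast hd
  have hw := continuous_sliceWeight hd
  have hpos := integral_sliceWeight_pos hd
  rw [formFactor_eq, abs_div, abs_of_pos hpos, div_le_iff₀ hpos,
    integral_even_eq (f := fun v => sliceWeight d v * Real.cos (t * v))
      (hw.mul (by fun_prop)) (fun v => by rw [sliceWeight_neg, mul_neg, Real.cos_neg]),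
    abs_mul, abs_two]
  calc 2 * |∫ v in (0 : ℝ)..1, sliceWeight d v * Real.cos (t * v)| ≤ 2 * (1 / t) := by
        gcongr
        exact abs_integral_sliceWeight_mul_cos_le hd ht
    _ = d / t * (2 / d) := by field_simp
    _ ≤ _ := by
        gcongr
        exact two_div_le_integral_sliceWeight hd

theorem integral_mul_sin (t : ℝ) :
    ∫ r in (0 : ℝ)..t, r * Real.sin r = Real.sin t - t * Real.cos t := by
  have h : ∀ r ∈ uIcc 0 t, HasDerivAt (fun r => Real.sin r - r * Real.cos r) (r * Real.sin r) r := by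
    intro r _
    have := (Real.hasDerivAt_sin r).sub ((hasDerivAt_id r).mul (Real.hasDerivAt_cos r))
    convert! this using 1
    simp
  rw [intervalIntegral.integral_eq_sub_of_hasDerivAt h
    (Continuous.intervalIntegrable (by fun_prop) _ _)]
  simp

theorem formFactor_three {t : ℝ} (ht : 0 < t) :
    formFactor 3 t = 3 * (Real.sin t - t * Real.cos t) / t ^ 3 := by
  have hw : ∀ v, sliceWeight 3 v = 1 - v ^ 2 := fun v => by
    rw [sliceWeight]
    norm_num
  have hden : ∫ v in (-1 : ℝ)..1, (1 - v ^ 2) = 4 / 3 := by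
    rw [intervalIntegral.integral_sub (by simp) (Continuous.intervalIntegrable (by fun_prop) _ _),
      integral_pow]
    norm_num
  have hnum : ∫ v in (-1 : ℝ)..1, (1 - v ^ 2) * Real.cos (t * v) =
      4 * (Real.sin t - t * Real.cos t) / t ^ 3 := by
    have h : ∀ v ∈ uIcc (-1 : ℝ) 1, HasDerivAt (fun v => (1 - v ^ 2) * (Real.sin (t * v) / t)
        - 2 * v * (Real.cos (t * v) / t ^ 2) + 2 * (Real.sin (t * v) / t ^ 3))
        ((1 - v ^ 2) * Real.cos (t * v)) v := by
      intro v _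
      have h0 : HasDerivAt (fun v : ℝ => t * v) t v := by
        simpa using (hasDerivAt_id v).const_mul t
      have h1 : HasDerivAt (fun v : ℝ => 1 - v ^ 2) (-(2 * v)) v := by
        simpa using (hasDerivAt_pow 2 v).const_sub 1
      have h2 : HasDerivAt (fun v : ℝ => 2 * v) 2 v := by
        simpa using (hasDerivAt_id v).const_mul 2
      have := ((h1.mul (h0.sin.div_const t)).sub (h2.mul (h0.cos.div_const (t ^ 2)))).add
        ((h0.sin.div_const (t ^ 3)).const_mul 2)
      convert! this using 1
      field_simp
      ring
    rw [intervalIntegral.integral_eq_sub_of_hasDerivAt h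
      (Continuous.intervalIntegrable (by fun_prop) _ _)]
    simp
    field_simp
    ring
  rw [formFactor_eq]
  simp only [hw]
  rw [hnum, hden]
  ring

end FormFactor

/-! ### The Fourier transform of the indicator of a ball -/

section BallFourier

/-- The splitting of the first coordinate, `ℝ^{n+1} ≃ ℝ × ℝ^n`. -/
def splitFirst (n : ℕ) : Pos (n + 1) ≃ᵐ ℝ × Pos n :=
  ((MeasurableEquiv.toLp 2 (Fin (n + 1) → ℝ)).symm.trans
    (MeasurableEquiv.piFinSuccAbove (fun _ : Fin (n + 1) => ℝ) 0)).trans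
    ((MeasurableEquiv.refl ℝ).prodCongr (MeasurableEquiv.toLp 2 (Fin n → ℝ)))

theorem splitFirst_fst (n : ℕ) (u : Pos (n + 1)) : (splitFirst n u).1 = u 0 := rfl

theorem splitFirst_snd_apply (n : ℕ) (u : Pos (n + 1)) (i : Fin n) :
    (splitFirst n u).2 i = u i.succ := rfl

theorem measurePreserving_splitFirst (n : ℕ) :
    MeasurePreserving (splitFirst n) volume (volume.prod volume) := by
  have h1 := EuclideanSpace.volume_preserving_symm_measurableEquiv_toLp (Fin (n + 1))
  have h2 := volume_preserving_piFinSuccAbove (fun _ : Fin (n + 1) => ℝ) 0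
  have h3 : MeasurePreserving (Prod.map id (WithLp.toLp 2) : ℝ × (Fin n → ℝ) → ℝ × Pos n)
      (volume.prod volume) (volume.prod volume) :=
    (MeasurePreserving.id volume).prod (PiLp.volume_preserving_toLp (Fin n))
  exact h3.comp (h2.comp h1)

theorem norm_sq_eq_splitFirst (n : ℕ) (u : Pos (n + 1)) :
    ‖u‖ ^ 2 = (splitFirst n u).1 ^ 2 + ‖(splitFirst n u).2‖ ^ 2 := by
  rw [EuclideanSpace.norm_sq_eq, EuclideanSpace.norm_sq_eq, Fin.sum_univ_succ]
  simp only [splitFirst_fst, splitFirst_snd_apply, Real.norm_eq_abs, sq_abs]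

/-- The slice is a ball of radius `√(1 - v²)` in dimension `n`, whence the exponent `n/2` in the
weight. -/
theorem volume_real_slice (n : ℕ) {v : ℝ} (hv : v ∈ Ioo (-1 : ℝ) 1) :
    volume.real {y : Pos n | v ^ 2 + ‖y‖ ^ 2 < 1} =
      volume.real (Metric.ball (0 : Pos n) 1) * sliceWeight (n + 1) v := by
  have hpos : 0 < 1 - v ^ 2 := by nlinarith [hv.1, hv.2]
  have hset : {y : Pos n | v ^ 2 + ‖y‖ ^ 2 < 1} = Metric.ball 0 (Real.sqrt (1 - v ^ 2)) := by
    ext y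
    rw [mem_ofPred_eq, mem_ball_zero_iff, Real.lt_sqrt (norm_nonneg y)]
    constructor <;> intro h <;> linarith
  rw [hset, measureReal_def, Measure.addHaar_ball_of_pos _ _ (Real.sqrt_pos.2 hpos),
    ENNReal.toReal_mul, ENNReal.toReal_ofReal (by positivity), finrank_euclideanSpace_fin,
    ← measureReal_def, mul_comm, sliceWeight]
  congr 1
  rw [Real.sqrt_eq_rpow, ← Real.rpow_natCast, ← Real.rpow_mul hpos.le]
  congr 1
  push_cast
  ring

/-- Integration over the unit ball of a function of one coordinate. -/
theorem integral_unitBall_coord (n : ℕ) {g : ℝ → ℂ} (hg : Continuous g) :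
    ∫ u in Metric.ball (0 : Pos (n + 1)) 1, g (u 0) =
      (volume.real (Metric.ball (0 : Pos n) 1) : ℂ) *
        ∫ v in (-1 : ℝ)..1, (sliceWeight (n + 1) v : ℂ) * g v := by
  let S : Set (ℝ × Pos n) := {z | z.1 ^ 2 + ‖z.2‖ ^ 2 < 1}
  have hS : MeasurableSet S :=
    (isOpen_lt (by fun_prop) continuous_const).measurableSet
  have hpre : splitFirst n ⁻¹' S = Metric.ball (0 : Pos (n + 1)) 1 := by
    ext u
    rw [mem_preimage, mem_ball_zero_iff, ← abs_norm u, ← sq_lt_one_iff_abs_lt_one,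
      norm_sq_eq_splitFirst]
    rfl
  have hmp := measurePreserving_splitFirst n
  have hemb := (splitFirst n).measurableEmbedding
  have hint : IntegrableOn (fun z : ℝ × Pos n => g z.1) S (volume.prod volume) := by
    rw [← hmp.integrableOn_comp_preimage hemb, hpre]
    have hc : Continuous ((fun z : ℝ × Pos n => g z.1) ∘ splitFirst n) := by
      change Continuous fun u : Pos (n + 1) => g (u 0)
      fun_prop
    exact (hc.continuousOn.integrableOn_compact (isCompact_closedBall 0 1)).mono_set
      Metric.ball_subset_closedBall
  calc ∫ u in Metric.ball (0 : Pos (n + 1)) 1, g (u 0)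
      = ∫ z in S, g z.1 ∂(volume.prod volume) := by
        rw [← hpre]
        exact hmp.setIntegral_preimage_emb hemb (fun z => g z.1) S
    _ = ∫ v, ∫ y, S.indicator (fun z => g z.1) (v, y) := by
        rw [← integral_indicator hS, integral_prod _ ((integrable_indicator_iff hS).2 hint)]
    _ = ∫ v, (volume.real {y : Pos n | v ^ 2 + ‖y‖ ^ 2 < 1} : ℂ) * g v := by
        refine integral_congr_ae (Eventually.of_forall fun v => ?_)
        have hSv : MeasurableSet {y : Pos n | v ^ 2 + ‖y‖ ^ 2 < 1} :=
          (isOpen_lt (by fun_prop) continuous_const).measurableSet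
        have e : (fun y => S.indicator (fun z => g z.1) (v, y)) =
            {y : Pos n | v ^ 2 + ‖y‖ ^ 2 < 1}.indicator fun _ => g v := rfl
        simp only [e]
        rw [integral_indicator hSv, setIntegral_const, Complex.real_smul]
    _ = ∫ v in Ioo (-1 : ℝ) 1, (volume.real {y : Pos n | v ^ 2 + ‖y‖ ^ 2 < 1} : ℂ) * g v := by
        rw [setIntegral_eq_integral_of_forall_compl_eq_zero]
        intro v hv
        have hempty : {y : Pos n | v ^ 2 + ‖y‖ ^ 2 < 1} = ∅ := by
          refine eq_empty_iff_forall_notMem.2 fun y hy => hv ?_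
          have h1 : v ^ 2 < 1 := by nlinarith [mem_ofPred_eq ▸ hy, sq_nonneg ‖y‖]
          exact abs_lt.1 (sq_lt_one_iff_abs_lt_one v |>.1 h1)
        rw [hempty, measureReal_empty, Complex.ofReal_zero, zero_mul]
    _ = ∫ v in Ioo (-1 : ℝ) 1, (volume.real (Metric.ball (0 : Pos n) 1) : ℂ) *
          ((sliceWeight (n + 1) v : ℂ) * g v) := by
        refine setIntegral_congr_fun measurableSet_Ioo fun v hv => ?_
        simp only [volume_real_slice n hv]
        push_cast
        ring
    _ = _ := by
        rw [integral_const_mul, intervalIntegral.integral_of_le (by norm_num),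
          integral_Ioc_eq_integral_Ioo]

/-- The weight is even, so the sine part integrates to zero. -/
theorem integral_sliceWeight_mul_exp {d : ℕ} (hd : 1 ≤ d) (t : ℝ) :
    ∫ v in (-1 : ℝ)..1, (sliceWeight d v : ℂ) * Complex.exp (Complex.I * ((t * v : ℝ) : ℂ)) =
      ((∫ v in (-1 : ℝ)..1, sliceWeight d v * Real.cos (t * v) : ℝ) : ℂ) := by
  have hw := continuous_sliceWeight hd
  have hsin : ∫ v in (-1 : ℝ)..1, sliceWeight d v * Real.sin (t * v) = 0 := by
    have h1 := intervalIntegral.integral_comp_neg (a := -1) (b := 1)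
      (fun v => sliceWeight d v * Real.sin (t * v))
    simp only [sliceWeight_neg, mul_neg, Real.sin_neg, intervalIntegral.integral_neg,
      neg_neg] at h1
    linarith
  have e : ∀ v : ℝ, (sliceWeight d v : ℂ) * Complex.exp (Complex.I * ((t * v : ℝ) : ℂ)) =
      ((sliceWeight d v * Real.cos (t * v) : ℝ) : ℂ) +
        ((sliceWeight d v * Real.sin (t * v) : ℝ) : ℂ) * Complex.I := by
    intro v
    rw [mul_comm Complex.I, Complex.exp_mul_I, ← Complex.ofReal_cos, ← Complex.ofReal_sin]
    push_cast
    ring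
  simp only [e]
  have hsw : Continuous fun v => ((sliceWeight d v * Real.sin (t * v) : ℝ) : ℂ) * Complex.I :=
    (Complex.continuous_ofReal.comp (hw.mul (by fun_prop))).mul_const _
  have hcw : Continuous fun v => ((sliceWeight d v * Real.cos (t * v) : ℝ) : ℂ) :=
    Complex.continuous_ofReal.comp (hw.mul (by fun_prop))
  rw [intervalIntegral.integral_add (hcw.intervalIntegrable _ _) (hsw.intervalIntegrable _ _),
    intervalIntegral.integral_mul_const, intervalIntegral.integral_ofReal,
    intervalIntegral.integral_ofReal, hsin, Complex.ofReal_zero, zero_mul, add_zero]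

theorem exists_unit_smul_eq {n : ℕ} (q : Pos (n + 1)) :
    ∃ e : Pos (n + 1), ‖e‖ = 1 ∧ q = ‖q‖ • e := by
  by_cases hq : q = 0
  · obtain ⟨e, he⟩ := exists_norm_eq (Pos (n + 1)) zero_le_one
    exact ⟨e, he, by simp [hq]⟩
  · have hq' : ‖q‖ ≠ 0 := norm_ne_zero_iff.2 hq
    exact ⟨‖q‖⁻¹ • q, by rw [norm_smul, norm_inv, norm_norm, inv_mul_cancel₀ hq'],
      by rw [smul_inv_smul₀ hq']⟩

/-- Rotation invariance: completing `e` to an orthonormal basis gives a measure preserving isometry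
that turns `⟪e, u⟫` into the first coordinate. -/
theorem integral_unitBall_inner {n : ℕ} {e : Pos (n + 1)} (he : ‖e‖ = 1) (g : ℝ → ℂ) :
    ∫ u in Metric.ball (0 : Pos (n + 1)) 1, g ⟪e, u⟫_ℝ =
      ∫ u in Metric.ball (0 : Pos (n + 1)) 1, g (u 0) := by
  have horth : Orthonormal ℝ (({0} : Set (Fin (n + 1))).domRestrict fun _ => e) := by
    refine ⟨fun _ => he, fun i j hij => ?_⟩
    exact absurd (Subsingleton.elim i j) hij
  obtain ⟨b, hb⟩ := horth.exists_orthonormalBasis_extension_of_card_eq (by simp)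
  have hb0 : b 0 = e := hb 0 rfl
  have hmp := b.repr.measurePreserving
  have key := hmp.setIntegral_preimage_emb b.repr.toHomeomorph.measurableEmbedding
    (fun u : Pos (n + 1) => g (u 0)) (Metric.ball 0 1)
  rw [← key]
  have hpre : b.repr ⁻¹' Metric.ball (0 : Pos (n + 1)) 1 = Metric.ball 0 1 := by
    ext u
    simp
  rw [hpre]
  simp only [OrthonormalBasis.repr_apply_apply, hb0]

theorem integral_ball_eq {d : ℕ} (c : Pos d) {r : ℝ} (hr : 0 < r) (f : Pos d → ℂ) :
    ∫ u in Metric.ball c r, f u = (r : ℂ) ^ d * ∫ u in Metric.ball (0 : Pos d) 1, f (c + r • u) := by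
  have h1 := (measurePreserving_add_left (volume : Measure (Pos d)) c).setIntegral_preimage_emb
    (Homeomorph.addLeft c).measurableEmbedding f (Metric.ball c r)
  have hpre : (fun u => c + u) ⁻¹' Metric.ball c r = Metric.ball 0 r := by
    ext u
    simp
  rw [hpre] at h1
  have h2 := Measure.setIntegral_comp_smul_of_pos (volume : Measure (Pos d))
    (fun u => f (c + u)) (Metric.ball 0 1) hr
  rw [smul_unitBall_of_pos hr, h1, finrank_euclideanSpace_fin] at h2
  rw [h2, Complex.real_smul]
  push_cast
  rw [mul_inv_cancel_left₀ (pow_ne_zero _ (by exact_mod_cast hr.ne'))]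

/-- The Fourier transform of the characteristic function of a ball. -/
theorem integral_ball_exp {d : ℕ} (hd : 1 ≤ d) (c : Pos d) {r : ℝ} (hr : 0 < r) (q : Pos d) :
    ∫ u in Metric.ball c r, Complex.exp (Complex.I * (⟪q, u⟫_ℝ : ℂ)) =
      Complex.exp (Complex.I * (⟪q, c⟫_ℝ : ℂ)) * (volume.real (Metric.ball c r) : ℂ) *
        (formFactor d (r * ‖q‖) : ℂ) := by
  obtain ⟨n, rfl⟩ : ∃ n, d = n + 1 := ⟨d - 1, by omega⟩
  obtain ⟨e, he, hq⟩ := exists_unit_smul_eq q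
  -- The slicing formula for the constant 1 expresses the volume of the ball, so the factor from the
  -- lower dimensional unit ball cancels and only the quotient `F_d` remains.
  have hvol : (volume.real (Metric.ball c r) : ℂ) = (r : ℂ) ^ (n + 1) *
      ((volume.real (Metric.ball (0 : Pos n) 1) : ℂ) * ((∫ v in (-1 : ℝ)..1, sliceWeight (n + 1) v : ℝ) : ℂ)) := by
    have h1 := integral_ball_eq c hr fun _ => (1 : ℂ)
    rw [setIntegral_const, Complex.real_smul, mul_one,
      integral_unitBall_coord n (g := fun _ => 1) continuous_const] at h1
    simp only [mul_one] at h1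
    rw [h1, intervalIntegral.integral_ofReal]
  have hexp : ∀ u : Pos (n + 1), Complex.exp (Complex.I * (⟪q, c + r • u⟫_ℝ : ℂ)) =
      Complex.exp (Complex.I * (⟪q, c⟫_ℝ : ℂ)) *
        Complex.exp (Complex.I * ((r * ‖q‖ * ⟪e, u⟫_ℝ : ℝ) : ℂ)) := by
    intro u
    rw [← Complex.exp_add, inner_add_right, inner_smul_right]
    have : ⟪q, u⟫_ℝ = ‖q‖ * ⟪e, u⟫_ℝ := by
      conv_lhs => rw [hq, real_inner_smul_left]
    rw [this]
    push_cast
    congr 1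
    ring
  rw [integral_ball_eq c hr]
  simp only [hexp]
  rw [integral_const_mul,
    integral_unitBall_inner he fun x => Complex.exp (Complex.I * ((r * ‖q‖ * x : ℝ) : ℂ)),
    integral_unitBall_coord n (g := fun x => Complex.exp (Complex.I * ((r * ‖q‖ * x : ℝ) : ℂ)))
      (by fun_prop),
    integral_sliceWeight_mul_exp hd, hvol, formFactor_eq]
  have hD : ((∫ v in (-1 : ℝ)..1, sliceWeight (n + 1) v : ℝ) : ℂ) ≠ 0 := by
    exact_mod_cast (integral_sliceWeight_pos hd).ne'
  push_cast
  field_simp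

end BallFourier

/-! ### Localized plane waves -/

section LocalizedPlaneWave

variable {d : ℕ} {c : Pos d} {r : ℝ}

theorem volume_real_ball_pos (c : Pos d) (hr : 0 < r) : 0 < volume.real (Metric.ball c r) :=
  ENNReal.toReal_pos (Metric.measure_ball_pos volume c hr).ne' measure_ball_lt_top.ne

theorem coeFn_planeWave (c : Pos d) (r : ℝ) (k : Pos d) :
    ⇑(planeWave c r k) =ᵐ[volume] planeWaveFun (Metric.ball c r) k :=
  MemLp.coeFn_toLp _

theorem planeWave_mem_l2On (c : Pos d) (r : ℝ) (k : Pos d) :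
    planeWave c r k ∈ L2On (Metric.ball c r) := by
  simp only [L2On, mem_ofPred_eq]
  filter_upwards [coeFn_planeWave c r k] with u hu hout
  rw [hu, planeWaveFun, indicator_of_notMem hout]

theorem inner_planeWave {f : OneParticle d} (hf : f ∈ L2On (Metric.ball c r)) (p : Pos d) :
    ⟪planeWave c r p, f⟫_ℂ = (((Real.sqrt (volume.real (Metric.ball c r)))⁻¹ : ℝ) : ℂ) *
      ∫ u, Complex.exp (-Complex.I * (⟪p, u⟫_ℝ : ℂ)) * f u := by
  rw [L2.inner_def, ← integral_const_mul]
  refine integral_congr_ae ?_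
  filter_upwards [coeFn_planeWave c r p, hf] with u hu hfu
  rw [hu, RCLike.inner_apply]
  by_cases hin : u ∈ Metric.ball c r
  · rw [planeWaveFun, indicator_of_mem hin, map_mul, Complex.conj_ofReal, ← Complex.exp_conj,
      map_mul, Complex.conj_I, Complex.conj_ofReal]
    ring
  · rw [hfu hin]
    simp

theorem inner_planeWave_planeWave (hd : 1 ≤ d) (c : Pos d) (hr : 0 < r) (p k : Pos d) :
    ⟪planeWave c r p, planeWave c r k⟫_ℂ =
      Complex.exp (Complex.I * (⟪k - p, c⟫_ℝ : ℂ)) * (formFactor d (r * ‖k - p‖) : ℂ) := by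
  have hV := volume_real_ball_pos c hr
  rw [inner_planeWave (planeWave_mem_l2On c r k)]
  have e : ∫ u, Complex.exp (-Complex.I * (⟪p, u⟫_ℝ : ℂ)) * planeWave c r k u =
      ∫ u in Metric.ball c r, (((Real.sqrt (volume.real (Metric.ball c r)))⁻¹ : ℝ) : ℂ) *
        Complex.exp (Complex.I * (⟪k - p, u⟫_ℝ : ℂ)) := by
    rw [← integral_indicator measurableSet_ball]
    refine integral_congr_ae ?_
    filter_upwards [coeFn_planeWave c r k] with u hu
    rw [hu, planeWaveFun]
    by_cases hin : u ∈ Metric.ball c r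
    · rw [indicator_of_mem hin, indicator_of_mem hin, mul_left_comm, ← Complex.exp_add,
        inner_sub_left]
      push_cast
      congr 2
      ring
    · rw [indicator_of_notMem hin, indicator_of_notMem hin, mul_zero]
  rw [e, integral_const_mul, integral_ball_exp hd c hr]
  have h1 : (((Real.sqrt (volume.real (Metric.ball c r)))⁻¹ : ℝ) : ℂ) *
      (((Real.sqrt (volume.real (Metric.ball c r)))⁻¹ : ℝ) : ℂ) *
      (volume.real (Metric.ball c r) : ℂ) = 1 := by
    rw [← Complex.ofReal_mul, ← Complex.ofReal_mul, ← mul_inv, Real.mul_self_sqrt hV.le,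
      inv_mul_cancel₀ hV.ne', Complex.ofReal_one]
  linear_combination (Complex.exp (Complex.I * (⟪k - p, c⟫_ℝ : ℂ)) *
    (formFactor d (r * ‖k - p‖) : ℂ)) * h1

theorem norm_planeWave (hd : 1 ≤ d) (c : Pos d) (hr : 0 < r) (p : Pos d) :
    ‖planeWave c r p‖ = 1 := by
  have h1 := inner_planeWave_planeWave hd c hr p p
  rw [sub_self, inner_zero_left, Complex.ofReal_zero, mul_zero, Complex.exp_zero, norm_zero,
    mul_zero, formFactor_zero hd, Complex.ofReal_one, mul_one, inner_self_eq_norm_sq_to_K] at h1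
  have h2 : ‖planeWave c r p‖ ^ 2 = 1 := Complex.ofReal_injective (by simpa using h1)
  exact (pow_eq_one_iff_of_nonneg (norm_nonneg _) two_ne_zero).1 h2

theorem integral_exp_mul_momentumShift (p x : Pos d) (f : OneParticle d) :
    ∫ u, Complex.exp (-Complex.I * (⟪p, u⟫_ℝ : ℂ)) * momentumShift x f u =
      Complex.exp (Complex.I * (⟪p, x⟫_ℝ : ℂ)) *
        ∫ u, Complex.exp (-Complex.I * (⟪p, u⟫_ℝ : ℂ)) * f u := by
  rw [← integral_const_mul, ← integral_add_right_eq_self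
    (fun u => Complex.exp (Complex.I * (⟪p, x⟫_ℝ : ℂ)) *
      (Complex.exp (-Complex.I * (⟪p, u⟫_ℝ : ℂ)) * f u)) x]
  refine integral_congr_ae ?_
  filter_upwards [coeFn_momentumShift x f] with u hu
  rw [hu, ← mul_assoc, ← Complex.exp_add, inner_add_right]
  push_cast
  congr 2
  ring

/-- Cauchy-Schwarz against the normalized plane wave of the ball supporting `f`; applied to the
small ball, it is the source of the factor `|O₀|` in the error of (i). -/
theorem norm_integral_exp_mul_le (hd : 1 ≤ d) (hr : 0 < r) {f : OneParticle d}
    (hf : f ∈ L2On (Metric.ball c r)) (p : Pos d) :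
    ‖∫ u, Complex.exp (-Complex.I * (⟪p, u⟫_ℝ : ℂ)) * f u‖ ≤
      Real.sqrt (volume.real (Metric.ball c r)) * ‖f‖ := by
  have hV := Real.sqrt_pos.2 (volume_real_ball_pos c hr)
  have h1 := norm_inner_le_norm (𝕜 := ℂ) (planeWave c r p) f
  rw [inner_planeWave hf, norm_mul, Complex.norm_real, Real.norm_of_nonneg (by positivity),
    norm_planeWave hd c hr, one_mul] at h1
  rwa [inv_mul_le_iff₀ hV] at h1

theorem two_pi_pow_mul_norm_fourierTransform_sq (f : OneParticle d) (p : Pos d) :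
    (2 * Real.pi) ^ d * ‖fourierTransform f p‖ ^ 2 =
      ‖∫ u, Complex.exp (-Complex.I * (⟪p, u⟫_ℝ : ℂ)) * f u‖ ^ 2 := by
  have hpi : 0 < 2 * Real.pi := by positivity
  rw [fourierTransform, norm_mul, Complex.norm_real,
    Real.norm_of_nonneg (Real.rpow_nonneg hpi.le _)]
  have h1 : (2 * Real.pi) ^ d * ((2 * Real.pi) ^ (-(d : ℝ) / 2)) ^ 2 = 1 := by
    rw [← Real.rpow_natCast, ← Real.rpow_natCast, ← Real.rpow_mul hpi.le, ← Real.rpow_add hpi]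
    have : (d : ℝ) + -(d : ℝ) / 2 * ((2 : ℕ) : ℝ) = 0 := by
      push_cast
      ring
    rw [this, Real.rpow_zero]
  linear_combination
    ‖∫ u, Complex.exp (-Complex.I * (⟪p, u⟫_ℝ : ℂ)) * f u‖ ^ 2 * h1

theorem closure_ball_add_subset_iff (hd : 1 ≤ d) {ρ R : ℝ} (hρ : 0 < ρ) (x : Pos d) :
    closure (Metric.ball (c + x) ρ) ⊆ Metric.ball c R ↔ ‖x‖ + ρ < R := by
  obtain ⟨n, rfl⟩ : ∃ n, d = n + 1 := ⟨d - 1, by omega⟩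
  rw [closure_ball _ hρ.ne']
  constructor
  · intro h
    obtain ⟨e, he, hx⟩ := exists_unit_smul_eq x
    -- This point of the closed ball is farthest from `c`, at distance `‖x‖ + ρ`.
    have hmem : c + x + ρ • e ∈ Metric.closedBall (c + x) ρ := by
      rw [Metric.mem_closedBall, dist_eq_norm, add_sub_cancel_left, norm_smul, he, mul_one,
        Real.norm_of_nonneg hρ.le]
    have h1 := h hmem
    rw [Metric.mem_ball, dist_eq_norm, add_assoc, add_sub_cancel_left] at h1
    have h2 : x + ρ • e = (‖x‖ + ρ) • e := by rw [add_smul, ← hx]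
    rwa [h2, norm_smul, he, mul_one, Real.norm_of_nonneg (by positivity)] at h1
  · intro h
    refine Metric.closedBall_subset_ball' ?_
    rw [dist_eq_norm, add_sub_cancel_left]
    linarith

theorem norm_lt_iff_exists_sub_eq (hd : 1 ≤ d) {L₀ L : ℝ} (hL₀ : 0 < L₀) (v : Pos d) :
    ‖v‖ < L - L₀ ↔ ∃ x y : Pos d, x - y = v ∧
      closure (Metric.ball (c + x) (L₀ / 2)) ⊆ Metric.ball c (L / 2) ∧
      closure (Metric.ball (c + y) (L₀ / 2)) ⊆ Metric.ball c (L / 2) := by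
  simp only [closure_ball_add_subset_iff hd (half_pos hL₀)]
  constructor
  · intro h
    -- The symmetric splitting of `v` makes both displacements as short as possible.
    refine ⟨(1 / 2 : ℝ) • v, -((1 / 2 : ℝ) • v), ?_, ?_, ?_⟩
    · rw [sub_neg_eq_add, ← add_smul]
      norm_num
    · rw [norm_smul]
      norm_num
      linarith
    · rw [norm_neg, norm_smul]
      norm_num
      linarith
  · rintro ⟨x, y, rfl, hx, hy⟩
    linarith [norm_sub_le x y]

theorem momentumShift_mem_l2On_ball (hd : 1 ≤ d) {ρ R : ℝ} (hρ : 0 < ρ) {x : Pos d}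
    (hx : closure (Metric.ball (c + x) ρ) ⊆ Metric.ball c R) {f : OneParticle d}
    (hf : f ∈ L2On (Metric.ball c ρ)) : momentumShift x f ∈ L2On (Metric.ball c R) := by
  rw [closure_ball_add_subset_iff hd hρ] at hx
  refine L2On_mono ?_ (momentumShift_mem_l2On hf)
  rintro _ ⟨u, hu, rfl⟩
  rw [Metric.mem_ball, dist_eq_norm] at *
  calc ‖u - x - c‖ = ‖(u - c) - x‖ := by congr 1; abel
    _ ≤ ‖u - c‖ + ‖x‖ := norm_sub_le _ _
    _ < R := by linarith

variable {ω : ℝ → FockState d} {s : OneParticle d}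

theorem IsHomogeneousCondensate.exists_eq_smul_planeWave (hd : 1 ≤ d)
    (h : IsHomogeneousCondensate ω (Metric.ball c r) s) (hr : 0 < r) :
    ∃ p : Pos d, ∃ z : ℂ, ‖z‖ = 1 ∧ s = z • planeWave c r p := by
  obtain ⟨p, K, hK⟩ := h.exists_ae_eq_exp hr
  have hV : ((Real.sqrt (volume.real (Metric.ball c r)) : ℝ) : ℂ) ≠ 0 := by
    exact_mod_cast (Real.sqrt_pos.2 (volume_real_ball_pos c hr)).ne'
  have hs : s = (K * (Real.sqrt (volume.real (Metric.ball c r)) : ℂ)) • planeWave c r p := by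
    refine Lp.ext ?_
    filter_upwards [hK, h.mem_l2On, coeFn_planeWave c r p,
      Lp.coeFn_smul (K * (Real.sqrt (volume.real (Metric.ball c r)) : ℂ)) (planeWave c r p)]
      with u h1 h2 h3 h4
    rw [h4, Pi.smul_apply, h3, planeWaveFun]
    by_cases hu : u ∈ Metric.ball c r
    · rw [h1 hu, indicator_of_mem hu, smul_eq_mul, Complex.ofReal_inv]
      field_simp
    · rw [h2 hu, indicator_of_notMem hu, smul_zero]
  refine ⟨p, _, ?_, hs⟩
  have h1 := h.norm_eq_one
  rwa [hs, norm_smul, norm_planeWave hd c hr, mul_one] at h1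

/-- `Q` bounds the squared overlaps with `s`: it is `|O₀|/|O|` in (i) and 1 in (ii). The hypothesis
`n ≤ n_C Q` lets the geometric mean absorb the regular term `n`; with the two cross terms this makes
3. -/
theorem IsProperCondensate.norm_corr_sub_le_three_mul {O : Set (Pos d)}
    (h : IsProperCondensate ω O s) {n σ Q : ℝ} (hn : 0 ≤ n) (hR : RegularBound ω O n σ)
    {F G : OneParticle d} (hF : F ∈ L2On O) (hG : G ∈ L2On O) (hF1 : ‖F‖ = 1) (hG1 : ‖G‖ = 1)
    (hFQ : ‖⟪s, F⟫_ℂ‖ ≤ Real.sqrt Q) (hGQ : ‖⟪s, G⟫_ℂ‖ ≤ Real.sqrt Q)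
    (hnQ : n ≤ (ω σ).occupation s * Q) :
    ‖(ω σ).corr F G - ((ω σ).occupation s : ℂ) * (⟪s, F⟫_ℂ * ⟪G, s⟫_ℂ)‖ ≤
      3 * Real.sqrt (n * (ω σ).occupation s * Q) := by
  have hN := (ω σ).occupation_nonneg s
  have h1 := h.norm_corr_sub_le hn hR hF hG
  rw [hF1, hG1, mul_one, mul_one, mul_one, mul_one] at h1
  have h2 : n ≤ Real.sqrt (n * (ω σ).occupation s * Q) := by
    refine Real.le_sqrt_of_sq_le ?_
    rw [sq, mul_assoc]
    exact mul_le_mul_of_nonneg_left hnQ hn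
  rw [Real.sqrt_mul (by positivity)] at h2 ⊢
  have h3 : Real.sqrt (n * (ω σ).occupation s) * (‖⟪s, F⟫_ℂ‖ + ‖⟪s, G⟫_ℂ‖) ≤
      Real.sqrt (n * (ω σ).occupation s) * (Real.sqrt Q + Real.sqrt Q) := by
    gcongr
  linarith

end LocalizedPlaneWave

end BoseGas

end

/-! ### Conclusion: the overlaps with `s` inserted into the general estimate -/

theorem theorem3p2 (d : ℕ) (hd : 1 ≤ d) (c : Pos d) (L₀ L : ℝ) (hL₀ : 0 < L₀) (hL : L₀ < L)
    (ω : ℝ → FockState d) (s : OneParticle d)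
    (hω : IsHomogeneousCondensate ω (Metric.ball c (L / 2)) s) :
    -- the condensate has a sharp momentum `p`
    ∃ p : Pos d, (∃ z : ℂ, ‖z‖ = 1 ∧ s = z • planeWave c (L / 2) p) ∧
    -- the occupation of regular wave functions is uniformly bounded for large `σ` ...
    (∃ n_R : ℝ, 0 ≤ n_R ∧ ∃ σ₀ : ℝ, 0 < σ₀ ∧
      ∀ σ, σ₀ ≤ σ → RegularBound ω (Metric.ball c (L / 2)) n_R σ) ∧
    -- ... and the number of particles in the condensate is not
    (∀ M : ℝ, ∃ᶠ σ in atTop, M < (ω σ).occupation s) ∧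
    (∀ n_R : ℝ, 0 ≤ n_R → ∀ σ : ℝ, 0 < σ → RegularBound ω (Metric.ball c (L / 2)) n_R σ →
      -- off-diagonal long range order
      ((ω σ).occupation s / volume.real (Metric.ball c (L / 2)) >
          n_R / volume.real (Metric.ball c (L₀ / 2)) →
        ∀ f ∈ L2On (Metric.ball c (L₀ / 2)), ‖f‖ = 1 →
        ∀ x y : Pos d,
          closure (Metric.ball (c + x) (L₀ / 2)) ⊆ Metric.ball c (L / 2) →
          closure (Metric.ball (c + y) (L₀ / 2)) ⊆ Metric.ball c (L / 2) →
          ‖(ω σ).corr (momentumShift x f) (momentumShift y f) -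
              (((ω σ).occupation s / volume.real (Metric.ball c (L / 2)) : ℝ) : ℂ) *
                Complex.exp (Complex.I * (inner ℝ (x - y) p : ℂ)) *
                (((2 * Real.pi) ^ d * ‖fourierTransform f p‖ ^ 2 : ℝ) : ℂ)‖
            ≤ 3 * Real.sqrt (n_R * (ω σ).occupation s *
                volume.real (Metric.ball c (L₀ / 2)) / volume.real (Metric.ball c (L / 2)))) ∧
      -- momentum distribution of the localized plane waves
      ((ω σ).occupation s > n_R →
        (ω σ).occupation (planeWave c (L / 2) p) = (ω σ).occupation s ∧
        ∀ k : Pos d,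
          |(ω σ).occupation (planeWave c (L / 2) k) -
              (ω σ).occupation s * formFactor d (L * ‖k - p‖ / 2) ^ 2|
            ≤ 3 * Real.sqrt (n_R * (ω σ).occupation s))) ∧
    -- the distances `|x - y|` between the admissible balls fill `[0, L - L₀)`
    (∀ v : Pos d, ‖v‖ < L - L₀ ↔ ∃ x y : Pos d, x - y = v ∧
      closure (Metric.ball (c + x) (L₀ / 2)) ⊆ Metric.ball c (L / 2) ∧
      closure (Metric.ball (c + y) (L₀ / 2)) ⊆ Metric.ball c (L / 2)) ∧
    -- the leading term has its peak at `k = p`, and decays away from it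
    formFactor d 0 = 1 ∧
    (∀ t : ℝ, 0 < t → |formFactor d t| < 1 ∧ |formFactor d t| ≤ d / t) ∧
    -- the form factor in three dimensions
    (d = 3 → ∀ t : ℝ, 0 < t →
      formFactor d t ^ 2 =
        (d : ℝ) ^ 2 / t ^ (2 * d) * (∫ r in (0 : ℝ)..t, r ^ (d - 2) * Real.sin r) ^ 2) := by
  have hL' : 0 < L / 2 := half_pos (hL₀.trans hL)
  have hL₀' : 0 < L₀ / 2 := half_pos hL₀
  obtain ⟨p, z, hz, hs⟩ := hω.exists_eq_smul_planeWave hd hL'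
  have hP := hω.toIsProperCondensate
  have hV := volume_real_ball_pos c hL'
  have hV₀ := volume_real_ball_pos c hL₀'
  refine ⟨p, ⟨z, hz, hs⟩, hP.exists_regularBound, hP.frequently_lt, ?_,
    norm_lt_iff_exists_sub_eq hd hL₀, formFactor_zero hd,
    fun t ht => ⟨abs_formFactor_lt_one hd ht, abs_formFactor_le hd ht⟩, ?_⟩
  · intro n hn σ _ hR
    refine ⟨fun hN f hf hf1 x y hx hy => ?_, fun hN => ⟨?_, fun k => ?_⟩⟩
    -- The density condition is `n_R ≤ n_C Q` for `Q = |O₀|/|O|`.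
    · have hN' : n ≤ (ω σ).occupation s * (volume.real (Metric.ball c (L₀ / 2)) /
          volume.real (Metric.ball c (L / 2))) := by
        rw [gt_iff_lt, div_lt_div_iff₀ hV₀ hV] at hN
        rw [← mul_div_assoc, le_div_iff₀ hV]
        exact hN.le
      have hshift := fun {x : Pos d}
        (hx : closure (Metric.ball (c + x) (L₀ / 2)) ⊆ Metric.ball c (L / 2)) =>
        momentumShift_mem_l2On_ball hd hL₀' hx hf
      set J := ∫ u, Complex.exp (-Complex.I * (inner ℝ p u : ℂ)) * f u with hJ
      have hin : ∀ {x : Pos d},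
          closure (Metric.ball (c + x) (L₀ / 2)) ⊆ Metric.ball c (L / 2) →
          inner ℂ s (momentumShift x f) = starRingEnd ℂ z *
            ((((Real.sqrt (volume.real (Metric.ball c (L / 2))))⁻¹ : ℝ) : ℂ) *
              (Complex.exp (Complex.I * (inner ℝ p x : ℂ)) * J)) := by
        intro x hx
        rw [hs, inner_smul_left, inner_planeWave (hshift hx), integral_exp_mul_momentumShift]
      have hle : ∀ {x : Pos d},
          closure (Metric.ball (c + x) (L₀ / 2)) ⊆ Metric.ball c (L / 2) →
          ‖inner ℂ s (momentumShift x f)‖ ≤ Real.sqrt (volume.real (Metric.ball c (L₀ / 2)) /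
            volume.real (Metric.ball c (L / 2))) := by
        intro x hx
        have h1 := norm_integral_exp_mul_le hd hL₀' hf p
        rw [hf1, mul_one] at h1
        rw [hin hx, norm_mul, norm_mul, norm_mul, RCLike.norm_conj, hz, one_mul,
          mul_comm Complex.I, Complex.norm_exp_ofReal_mul_I, one_mul, Complex.norm_real,
          Real.norm_of_nonneg (by positivity), Real.sqrt_div hV₀.le]
        exact (mul_le_mul_of_nonneg_left h1 (by positivity)).trans_eq (div_eq_inv_mul _ _).symm
      have key := hP.norm_corr_sub_le_three_mul hn hR (hshift hx) (hshift hy)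
        (by rw [norm_momentumShift, hf1]) (by rw [norm_momentumShift, hf1]) (hle hx) (hle hy) hN'
      rw [← mul_div_assoc] at key
      convert key using 3
      -- The phase `z` enters once with its conjugate and cancels; the shifts leave `e^{ipx}` and
      -- `e^{-ipy}`, which combine to `e^{i(x-y)p}`.
      have hzz : starRingEnd ℂ z * z = 1 := by
        rw [mul_comm, Complex.mul_conj, Complex.normSq_eq_norm_sq, hz]
        norm_num
      have hJJ : J * starRingEnd ℂ J = ((‖J‖ ^ 2 : ℝ) : ℂ) := by
        rw [Complex.mul_conj, Complex.normSq_eq_norm_sq]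
      have hVV : (((Real.sqrt (volume.real (Metric.ball c (L / 2))))⁻¹ : ℝ) : ℂ) *
          (((Real.sqrt (volume.real (Metric.ball c (L / 2))))⁻¹ : ℝ) : ℂ) =
          (((volume.real (Metric.ball c (L / 2)))⁻¹ : ℝ) : ℂ) := by
        rw [← Complex.ofReal_mul, ← mul_inv, Real.mul_self_sqrt hV.le]
      have hexp : Complex.exp (Complex.I * (inner ℝ (x - y) p : ℂ)) =
          Complex.exp (Complex.I * (inner ℝ p x : ℂ)) *
            Complex.exp (-Complex.I * (inner ℝ p y : ℂ)) := by
        rw [← Complex.exp_add, real_inner_comm, inner_sub_right]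
        push_cast
        congr 1
        ring
      rw [← inner_conj_symm (momentumShift y f) s, hin hx, hin hy,
        two_pi_pow_mul_norm_fourierTransform_sq, ← hJ, ← hJJ, hexp, div_eq_mul_inv,
        Complex.ofReal_mul, ← hVV]
      simp only [map_mul, Complex.conj_conj, Complex.conj_ofReal, ← Complex.exp_conj,
        Complex.conj_I]
      linear_combination (-((ω σ).occupation s : ℂ) *
        (((Real.sqrt (volume.real (Metric.ball c (L / 2))))⁻¹ : ℝ) : ℂ) ^ 2 *
        Complex.exp (Complex.I * (inner ℝ p x : ℂ)) *
        Complex.exp (-Complex.I * (inner ℝ p y : ℂ)) * J * starRingEnd ℂ J) * hzz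
    · rw [FockState.occupation_eq, FockState.occupation_eq, hs, map_smulₛₗ, norm_smul,
        RCLike.norm_conj, hz, one_mul]
    · have hin : inner ℂ s (planeWave c (L / 2) k) = starRingEnd ℂ z *
          (Complex.exp (Complex.I * (inner ℝ (k - p) c : ℂ)) *
            (formFactor d (L / 2 * ‖k - p‖) : ℂ)) := by
        rw [hs, inner_smul_left, inner_planeWave_planeWave hd c hL']
      have hnorm : ‖inner ℂ s (planeWave c (L / 2) k)‖ = |formFactor d (L * ‖k - p‖ / 2)| := by
        rw [hin, norm_mul, norm_mul, RCLike.norm_conj, hz, one_mul, mul_comm Complex.I,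
          Complex.norm_exp_ofReal_mul_I, one_mul, Complex.norm_real, Real.norm_eq_abs,
          div_mul_eq_mul_div]
      -- Both functions are normalized, so `Q = 1`.
      have hle : ‖inner ℂ s (planeWave c (L / 2) k)‖ ≤ Real.sqrt 1 := by
        have h1 := norm_inner_le_norm (𝕜 := ℂ) s (planeWave c (L / 2) k)
        rwa [hP.norm_eq_one, norm_planeWave hd c hL', mul_one, ← Real.sqrt_one] at h1
      have hk := planeWave_mem_l2On c (L / 2) k
      have hk1 := norm_planeWave hd c hL' k
      have key := hP.norm_corr_sub_le_three_mul hn hR hk hk hk1 hk1 hle hle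
        (by rw [mul_one]; exact hN.le)
      rw [FockState.corr_self, ← inner_conj_symm (planeWave c (L / 2) k) s, Complex.mul_conj,
        Complex.normSq_eq_norm_sq, hnorm, sq_abs, ← Complex.ofReal_mul, ← Complex.ofReal_sub,
        Complex.norm_real, Real.norm_eq_abs, mul_one] at key
      exact key
  · rintro rfl t ht
    -- In three dimensions the integrand is `r sin r`, and both sides equal `9 (sin t - t cos t)² /
    -- t⁶`.
    have h1 := integral_mul_sin t
    rw [formFactor_three ht]
    norm_num
    rw [h1]
    ring
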